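/- Let $d=m+n$ and let $\theta_1,\dots,\theta_m\in\mathbb Z^d$ be linearly independent. Let $M\subset T^d$ be the $m$-dimensional subtorus with Lie algebra $\mathfrak m=\mathrm{span}_{\mathbb R}(\theta_1,\dots,\theta_m)\subset\mathfrak t^d=\mathbb R^d$, i.e. the image of $T^m\to T^d$, $(s_k)\mapsto(\prod_k s_k^{\theta_{k,i}})_i$; let $\iota:\mathfrak m\to\mathfrak t^d$ be the inclusion, $N=T^d/M$ and $\mathfrak n=\mathfrak t^d/\mathfrak m$. The torus $T^d$ acts on $\mathbb H^d=T^*\mathbb C^d=\{(z,w)\in\mathbb C^d\times\mathbb C^d\}$ by $(z,w)\zeta=(z\zeta,w\zeta^{-1})$. With the flat metric $g$ and the complex structures $I_1(z,w)=(iz,iw)$, $I_2(z,w)=(i\bar w,-i\bar z)$, $I_3=I_1I_2$, and $\omega_j(u,v)=g(I_ju,v)$, the $M$-action has the hyperkähler moment map $$\mu_{\mathbb R}(z,w)=\tfrac12\sum_{i=1}^d(|z_i|^2-|w_i|^2)\,\iota^*e_i^*\in\mathfrak m^*,\qquad \mu_{\mathbb C}(z,w)=\sum_{i=1}^d z_iw_i\,\iota^*e_i^*\in\mathfrak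 m^*_{\mathbb C}.$$ Let $\alpha\in\mathfrak m^*$ and $\beta\in\mathfrak m^*_{\mathbb C}$ be such that $M$ acts freely on $\mu^{-1}(\alpha,\beta)$, so that the hyperkähler quotient $Y(\alpha,\beta)=\mu^{-1}(\alpha,\beta)/M$ is a smooth toric hyperkähler manifold. Its tangent space at $[p]$ is identified with the horizontal space at $p$ (the vectors tangent to $\mu^{-1}(\alpha,\beta)$ and orthogonal to the orbit $Mp$); its metric, complex structures and Kähler forms are the restrictions of the flat ones; and a function on it is holomorphic if it is smooth (its pullback to $\mu^{-1}(\alpha,\beta)$ extends locally to a smooth function) with $I_1$-complex-linear differential. Let $\omega_{\mathbb C}=\omega_2+i\omega_3$ be the holomorphic symplectic form of $(Y(\alpha,\beta),I_1)$. Fix $\lambda\in\mathbb C^d$ with $\iota^*\sum_i\lambda_ie_i^*=\beta$, and let $\bar\mu_{\mathbb C}:Y(\alpha,\beta)\to\mathfrak n^*_{\mathbb C}=\mathrm{Hom}_{\mathbb R}(\mathfrak n,\mathbb C)$ be the complex part of the moment map of the residual torus $N$, $$\bar\mu_{\mathbb C}([z,w])=\sum_{i=1}^d (z_iw_i-\lambda_i)\,e_i^*,$$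 a functional that vanishes on $\mathfrak m$ and is therefore regarded as an element of $\mathfrak n^*_{\mathbb C}$. Then $\dim_{\mathbb C}\mathfrak n^*_{\mathbb C}=n$, every tangent space of $Y(\alpha,\beta)$ has real dimension $4n$, and $\bar\mu_{\mathbb C}:Y(\alpha,\beta)\to\mathfrak n^*_{\mathbb C}\cong\mathbb C^n$ is a holomorphic Lagrangian fibration: it is holomorphic and surjective, and for every $b\in\mathfrak n^*_{\mathbb C}$ the fiber $F_b=\bar\mu_{\mathbb C}^{-1}(b)$ is a complex Lagrangian subvariety of $(Y(\alpha,\beta),I_1,\omega_{\mathbb C})$. That is, $F_b$ is a complex analytic subset (locally the zero locus of finitely many holomorphic functions), its smooth points (those near which it is the zero locus of holomorphic functions with linearly independent differentials at the point) are dense in it, and at each smooth point its tangent space (the common kernel of these differentials) is a Lagrangian subspace for $\omega_{\mathbb C}$, i.e. $\omega_{\mathbb C}$ vanishes on it and it has half the dimension of the tangent space of $Y(\alpha,\beta)$. -/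

import Mathlib

open scoped ContDiff

noncomputable section

namespace ToricHyperkahler

/-- The flat quaternionic space `ℍ^d = T^*ℂ^d`, with coordinates `(z, w)`. -/
abbrev HSpace (d : ℕ) : Type := (Fin d → ℂ) × (Fin d → ℂ)

/-- The complex structure `I₁ (z, w) = (i z, i w)`. -/
def I₁ {d : ℕ} (u : HSpace d) : HSpace d :=
  (fun i => Complex.I * u.1 i, fun i => Complex.I * u.2 i)

/-- The complex structure `I₂ (z, w) = (i w̄, -i z̄)`. -/
def I₂ {d : ℕ} (u : HSpace d) : HSpace d :=
  (fun i => Complex.I * star (u.2 i), fun i => -(Complex.I * star (u.1 i)))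

/-- The complex structure `I₃ = I₁ I₂`. -/
def I₃ {d : ℕ} (u : HSpace d) : HSpace d := I₁ (I₂ u)

/-- The flat Riemannian metric on `ℍ^d`. -/
def metric {d : ℕ} (u v : HSpace d) : ℝ :=
  ∑ i, ((u.1 i * star (v.1 i)).re + (u.2 i * star (v.2 i)).re)

/-- The Kähler form of `I₂`. -/
def ω₂ {d : ℕ} (u v : HSpace d) : ℝ := metric (I₂ u) v

/-- The Kähler form of `I₃`. -/
def ω₃ {d : ℕ} (u v : HSpace d) : ℝ := metric (I₃ u) v

/-- The holomorphic symplectic form `ω_ℂ = ω₂ + i ω₃` of `(ℍ^d, I₁)`. -/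
def omegaC {d : ℕ} (u v : HSpace d) : ℂ := (ω₂ u v : ℂ) + Complex.I * (ω₃ u v : ℂ)

/-- The action of the real torus `T^d`: `(z, w) ζ = (z ζ, w ζ⁻¹)`. -/
def torusAct {d : ℕ} (ζ : Fin d → Circle) (p : HSpace d) : HSpace d :=
  (fun i => p.1 i * (ζ i : ℂ), fun i => p.2 i * ((ζ i)⁻¹ : Circle))

/-- The subtorus `M ⊆ T^d` whose Lie algebra is spanned by the integer vectors `θ 0, …, θ (m-1)`:
the image of `T^m → T^d`, `s ↦ (∏ k, s_k ^ (θ k i))_i`. -/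
def subtorus {d m : ℕ} (θ : Fin m → Fin d → ℤ) : Subgroup (Fin d → Circle) where
  carrier := {ζ | ∃ s : Fin m → Circle, ζ = fun i => ∏ k, s k ^ θ k i}
  one_mem' := ⟨1, by ext; simp⟩
  mul_mem' := by
    rintro _ _ ⟨s, rfl⟩ ⟨t, rfl⟩
    exact ⟨s * t, by ext i; simp [mul_zpow, Finset.prod_mul_distrib]⟩
  inv_mem' := by
    rintro _ ⟨s, rfl⟩
    exact ⟨s⁻¹, by ext i; simp⟩

/-- The Lie algebra `𝔪 ⊆ 𝔱^d = ℝ^d` of the subtorus. -/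
def lieM {d m : ℕ} (θ : Fin m → Fin d → ℤ) : Submodule ℝ (Fin d → ℝ) :=
  Submodule.span ℝ (Set.range fun (k : Fin m) (i : Fin d) => (θ k i : ℝ))

/-- The Lie algebra `𝔫 = 𝔱^d / 𝔪` of the residual torus `N = T^d / M`. -/
abbrev LieN {d m : ℕ} (θ : Fin m → Fin d → ℤ) : Type := (Fin d → ℝ) ⧸ lieM θ

/-- The complexified dual `𝔫^*_ℂ = Hom_ℝ(𝔫, ℂ)`. -/
abbrev NStarC {d m : ℕ} (θ : Fin m → Fin d → ℤ) : Type := LieN θ →ₗ[ℝ] ℂ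

/-- The adjoint `ι^* : (𝔱^d)^*_ℂ → 𝔪^*_ℂ` of the inclusion `𝔪 ⊆ 𝔱^d`, in the basis `e_i^*` and
the dual basis `θ_k^*` of the `θ k`. -/
def iotaStar {d m : ℕ} (θ : Fin m → Fin d → ℤ) (y : Fin d → ℂ) : Fin m → ℂ :=
  fun k => ∑ i, y i * (θ k i : ℂ)

/-- The real moment map `½ ∑ (|z_i|² - |w_i|²) ι^* e_i^*` of `M`. -/
def muR {d m : ℕ} (θ : Fin m → Fin d → ℤ) (p : HSpace d) : Fin m → ℝ :=
  fun k => (1 / 2 : ℝ) * ∑ i, (‖p.1 i‖ ^ 2 - ‖p.2 i‖ ^ 2) * (θ k i : ℝ)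

/-- The complex moment map `∑ z_i w_i ι^* e_i^*` of `M`. -/
def muC {d m : ℕ} (θ : Fin m → Fin d → ℤ) (p : HSpace d) : Fin m → ℂ :=
  iotaStar θ fun i => p.1 i * p.2 i

/-- The level set `μ⁻¹(α, β)`. -/
def levelSet {d m : ℕ} (θ : Fin m → Fin d → ℤ) (α : Fin m → ℝ) (β : Fin m → ℂ) :
    Set (HSpace d) :=
  {p | muR θ p = α ∧ muC θ p = β}

/-- The relation "lies in the same `M`-orbit" on `μ⁻¹(α, β)`. -/
def orbitSetoid {d m : ℕ} (θ : Fin m → Fin d → ℤ) (α : Fin m → ℝ) (β : Fin m → ℂ) :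
    Setoid (levelSet θ α β) where
  r p q := ∃ ζ ∈ subtorus θ, torusAct ζ p.1 = q.1
  iseqv :=
    { refl := fun p => ⟨1, one_mem _, by ext i <;> simp [torusAct]⟩
      symm := by
        rintro p q ⟨ζ, hζ, h⟩
        refine ⟨ζ⁻¹, inv_mem hζ, ?_⟩
        rw [← h]
        ext i <;> simp [torusAct]
      trans := by
        rintro p q r ⟨ζ, hζ, h⟩ ⟨η, hη, h'⟩
        refine ⟨ζ * η, mul_mem hζ hη, ?_⟩
        rw [← h', ← h]
        ext i <;> simp [torusAct] <;> ring }

/-- The toric hyperkähler variety `Y(α, β) = μ⁻¹(α, β) / M`, with the quotient topology. -/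
abbrev Y {d m : ℕ} (θ : Fin m → Fin d → ℤ) (α : Fin m → ℝ) (β : Fin m → ℂ) : Type :=
  Quotient (orbitSetoid θ α β)

/-- The class `[z, w] ∈ Y(α, β)`. -/
def toY {d m : ℕ} {θ : Fin m → Fin d → ℤ} {α : Fin m → ℝ} {β : Fin m → ℂ}
    (p : levelSet θ α β) : Y θ α β :=
  Quotient.mk (orbitSetoid θ α β) p

/-- `M` acts freely on `μ⁻¹(α, β)`: the regularity condition under which the hyperkähler quotient
`Y(α, β)` is a smooth manifold. -/
def IsSmooth {d m : ℕ} (θ : Fin m → Fin d → ℤ) (α : Fin m → ℝ) (β : Fin m → ℂ) : Prop :=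
  ∀ ζ ∈ subtorus θ, ∀ p ∈ levelSet θ α β, torusAct ζ p = p → ζ = 1

/-- The complex moment map `μ̄_ℂ : Y(α, β) → 𝔫^*_ℂ` of the residual torus. The functional
`∑ z_i w_i e_i^*` lies in the affine space `{y | ι^* y = β}`, which is identified with
`𝔫^*_ℂ = {y | ι^* y = 0}` by subtracting a base point `lam` (take `lam = 0` if `β = 0`). -/
def residualMuC {d m : ℕ} (θ : Fin m → Fin d → ℤ) (α : Fin m → ℝ) (β : Fin m → ℂ)
    (lam : Fin d → ℂ) (hlam : iotaStar θ lam = β) : Y θ α β → NStarC θ :=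
  Quotient.lift
    (fun p : levelSet θ α β =>
      (lieM θ).liftQ
        (∑ i, (LinearMap.proj i : (Fin d → ℝ) →ₗ[ℝ] ℝ).smulRight
          (p.1.1 i * p.1.2 i - lam i))
        (by
          rw [lieM, Submodule.span_le]
          rintro _ ⟨k, rfl⟩
          have h := congrFun (p.2.2.trans hlam.symm) k
          simp only [muC, iotaStar] at h
          simp [LinearMap.sum_apply, mul_sub, Finset.sum_sub_distrib, sub_eq_zero]
          simpa [mul_comm, mul_left_comm, mul_assoc] using h))
    (by
      rintro p q ⟨ζ, -, h⟩
      have h1 : ∀ i, q.1.1 i * q.1.2 i = p.1.1 i * p.1.2 i := by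
        intro i
        rw [← h]
        have hne : (ζ i : ℂ) ≠ 0 := Circle.coe_ne_zero _
        simp only [torusAct, Circle.coe_inv]
        field_simp
      simp only [h1])

/-- The vector field on `ℍ^d` generated by `ξ ∈ 𝔱^d`. -/
def infinitesimal {d : ℕ} (ξ : Fin d → ℝ) (p : HSpace d) : HSpace d :=
  (fun i => Complex.I * ξ i * p.1 i, fun i => -(Complex.I * ξ i * p.2 i))

/-- The horizontal space at `p ∈ μ⁻¹(α, β)`: the vectors tangent to `μ⁻¹(α, β)` (that is, in the
kernel of `dμ`) and orthogonal to the orbit `M p`. This is the model of the tangent space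
`T_[p] Y(α, β) = T_p μ⁻¹(α, β) / T_p (M p)` in the hyperkähler quotient; the metric, the complex
structures and the Kähler forms of `Y(α, β)` at `[p]` are the restrictions of the flat ones. -/
def tangentY {d m : ℕ} (θ : Fin m → Fin d → ℤ) (p : HSpace d) : Submodule ℝ (HSpace d) where
  carrier := {v | fderiv ℝ (muR θ) p v = 0 ∧ fderiv ℝ (muC θ) p v = 0 ∧
    ∀ ξ ∈ lieM θ, metric (infinitesimal ξ p) v = 0}
  zero_mem' := by simp [metric]
  add_mem' := by
    rintro u v ⟨h1, h2, h3⟩ ⟨h1', h2', h3'⟩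
    refine ⟨by simp [h1, h1'], by simp [h2, h2'], fun ξ hξ => ?_⟩
    have e : metric (infinitesimal ξ p) (u + v) =
        metric (infinitesimal ξ p) u + metric (infinitesimal ξ p) v := by
      simp only [metric, ← Finset.sum_add_distrib]
      refine Finset.sum_congr rfl fun i _ => ?_
      simp only [Prod.fst_add, Prod.snd_add, Pi.add_apply, star_add, mul_add, Complex.add_re]
      ring
    rw [e, h3 ξ hξ, h3' ξ hξ, add_zero]
  smul_mem' := by
    rintro c v ⟨h1, h2, h3⟩
    refine ⟨by simp [h1], by simp [h2], fun ξ hξ => ?_⟩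
    have e : metric (infinitesimal ξ p) (c • v) = c * metric (infinitesimal ξ p) v := by
      simp only [metric, Finset.mul_sum]
      refine Finset.sum_congr rfl fun i _ => ?_
      simp [Complex.mul_re, Complex.mul_im]
      ring
    rw [e, h3 ξ hξ, mul_zero]

section

variable {d m : ℕ} {θ : Fin m → Fin d → ℤ} {α : Fin m → ℝ} {β : Fin m → ℂ}

/-- `F` is a smooth function on the open set `V ⊆ ℍ^d` which represents `f : Y(α, β) → ℂ` on
`V ∩ μ⁻¹(α, β)`, and the differential of `f` is `ℂ`-linear with respect to `I₁` there. -/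
structure IsHolomorphicLift (f : Y θ α β → ℂ) (V : Set (HSpace d)) (F : HSpace d → ℂ) :
    Prop where
  isOpen : IsOpen V
  smooth : ContDiffOn ℝ ∞ F V
  lift : ∀ p : levelSet θ α β, p.1 ∈ V → F p.1 = f (toY p)
  complexLinear : ∀ p : levelSet θ α β, p.1 ∈ V → ∀ v ∈ tangentY θ p.1,
    fderiv ℝ F p.1 (I₁ v) = Complex.I * fderiv ℝ F p.1 v

/-- `f` is holomorphic on `U ⊆ Y(α, β)` for the complex structure `I₁`: around every point of `U`
it is smooth, with `ℂ`-linear differential. -/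
def IsHolomorphicOn (f : Y θ α β → ℂ) (U : Set (Y θ α β)) : Prop :=
  ∀ p : levelSet θ α β, toY p ∈ U → ∃ V F, p.1 ∈ V ∧ IsHolomorphicLift f V F

/-- `D` is the differential at `[p]` of `f`, a function holomorphic near `[p]`. -/
def HasDifferentialAt (f : Y θ α β → ℂ) (p : levelSet θ α β)
    (D : tangentY θ p.1 →ₗ[ℝ] ℂ) : Prop :=
  ∃ V F, p.1 ∈ V ∧ IsHolomorphicLift f V F ∧ ∀ v : tangentY θ p.1, fderiv ℝ F p.1 v.1 = D v

/-- Holomorphic maps `Y(α, β) → 𝔫^*_ℂ`: all linear coordinates are holomorphic. -/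
def IsHolomorphicMap (μ : Y θ α β → NStarC θ) : Prop :=
  ∀ ξ : LieN θ, IsHolomorphicOn (fun y => μ y ξ) Set.univ

/-- Complex analytic subvarieties of `(Y(α, β), I₁)`: around every point of `Y(α, β)` the set is
the zero locus of finitely many holomorphic functions (in particular it is closed). -/
def IsAnalyticSubvariety (S : Set (Y θ α β)) : Prop :=
  ∀ y : Y θ α β, ∃ U : Set (Y θ α β), IsOpen U ∧ y ∈ U ∧
    ∃ (c : ℕ) (f : Fin c → Y θ α β → ℂ),
      (∀ j, IsHolomorphicOn (f j) U) ∧ S ∩ U = {x ∈ U | ∀ j, f j x = 0}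

/-- `[p]` is a smooth point of `S`, and `W ⊆ T_[p] Y(α, β)` is the tangent space of `S` there:
near `[p]` the set `S` is the zero locus of holomorphic functions whose differentials at `[p]` are
linearly independent over `ℂ` (that is, jointly surjective), and `W` is their common kernel. -/
def IsTangentSpaceAt (S : Set (Y θ α β)) (p : levelSet θ α β)
    (W : Submodule ℝ (tangentY θ p.1)) : Prop :=
  toY p ∈ S ∧ ∃ U : Set (Y θ α β), IsOpen U ∧ toY p ∈ U ∧
    ∃ (c : ℕ) (f : Fin c → Y θ α β → ℂ) (D : Fin c → tangentY θ p.1 →ₗ[ℝ] ℂ),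
      (∀ j, IsHolomorphicOn (f j) U) ∧ S ∩ U = {x ∈ U | ∀ j, f j x = 0} ∧
      (∀ j, HasDifferentialAt (f j) p (D j)) ∧
      Function.Surjective (fun (v : tangentY θ p.1) (j : Fin c) => D j v) ∧
      W = ⨅ j, LinearMap.ker (D j)

/-- Lagrangian subspaces of `(T_[p] Y(α, β), ω_ℂ)`: isotropic and of half the dimension. -/
def IsLagrangian {p : levelSet θ α β} (W : Submodule ℝ (tangentY θ p.1)) : Prop :=
  (∀ u ∈ W, ∀ v ∈ W, omegaC u.1 v.1 = 0) ∧
    2 * Module.finrank ℝ W = Module.finrank ℝ (tangentY θ p.1)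

/-- Complex Lagrangian subvarieties of `(Y(α, β), I₁, ω_ℂ)`: complex analytic subvarieties whose
tangent space at every smooth point is Lagrangian; the smooth points are dense. -/
structure IsComplexLagrangianSubvariety (S : Set (Y θ α β)) : Prop where
  analytic : IsAnalyticSubvariety S
  smooth_dense : S ⊆ closure {y | ∃ p W, toY p = y ∧ IsTangentSpaceAt S p W}
  lagrangian : ∀ p W, IsTangentSpaceAt S p W → IsLagrangian W

end

end ToricHyperkahler

end

noncomputable section

namespace ToricHyperkahler

open Filter Topology

variable {d m : ℕ} {θ : Fin m → Fin d → ℤ} {α : Fin m → ℝ} {β : Fin m → ℂ}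

/-! ### Linear algebra of a free torus action -/

/-! Everything is linear algebra over the coordinates `i`, organised by the set `Z` of those with
`z_i = w_i = 0` at a point. Horizontal vectors are cut out by two complex-linear conditions: `ι^*`
kills both `conjDiff` and `prodDiff` (`mem_tangentY_iff`). Freeness says that no non-zero element of
`𝔪` is supported on `Z`; dually, every functional on `𝔪` is induced by one vanishing on `Z`
(`exists_weights_of_injective`). Hence the equations are independent, which gives the dimension
`4n`.

A fiber of the residual moment map prescribes all products `z_i w_i` (`mem_fiber_iff`). With these
fixed, `momentCurve` still changes each `|z_i|² - |w_i|²` at will; this yields surjectivity, and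
density of the points with `Z` empty. At such points the products have enough independent
differentials, so they are smooth points.

The delicate claim is the Lagrangian property at every smooth point, since the defining functions
are arbitrary. They are eliminated through curves: one-sided velocities of curves in the fiber lie
in the tangent space `W`, and by the implicit function theorem every vector of `W` is such a
velocity. If `i ∈ Z`, the fiber contains a branch where `z_i` grows and one where `w_i` grows; the
sum of their velocities would be the velocity of a curve with `z_i w_i ≠ 0`, which is impossible
(`forall_ne_of_isTangentSpaceAt`). So `Z` is empty, and the torus directions together with their
multiples by `i` identify `W` with the horizontal kernel of `prodDiff` (`mem_iff_prodDiff_eq_zero`),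
which is isotropic of complex dimension `n`. -/

theorem exp_mem_subtorus (θ : Fin m → Fin d → ℤ) (a : Fin m → ℝ) (t : ℝ) :
    (fun i => Circle.exp (t * ∑ k, a k * θ k i)) ∈ subtorus θ := by
  refine ⟨fun k => Circle.exp (t * a k), ?_⟩
  funext i
  have hsum : ∀ f : Fin m → ℝ, Circle.exp (∑ k, f k) = ∏ k, Circle.exp (f k) := fun f =>
    map_sum Circle.expHom f Finset.univ
  rw [Finset.mul_sum, hsum]
  refine Finset.prod_congr rfl fun k _ => ?_
  rw [← Circle.exp_intCast_mul]
  congr 1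
  ring

theorem eq_zero_of_forall_exp_eq_one {x : ℝ} (h : ∀ t : ℝ, Circle.exp (t * x) = 1) : x = 0 := by
  by_contra hx
  -- At `t = π / x` the exponential is `-1`.
  have := congrArg (fun z : Circle => (z : ℂ)) (h (Real.pi / x))
  rw [div_mul_cancel₀ _ hx] at this
  norm_num at this

theorem linearIndependent_real (hθ : LinearIndependent ℤ θ) :
    LinearIndependent ℝ (fun (k : Fin m) (i : Fin d) => (θ k i : ℝ)) :=
  (linearIndependent_algebraMap_comp_iff (R := ℤ) (S := ℝ)).2 hθ

theorem eq_zero_of_sum_eq_zero (hθ : LinearIndependent ℤ θ) (a : Fin m → ℝ)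
    (h : ∀ i, ∑ k, a k * (θ k i : ℝ) = 0) : a = 0 := by
  funext k
  refine Fintype.linearIndependent_iff.1 (linearIndependent_real hθ) a ?_ k
  funext i
  simpa using h i

/-- A Lie algebra element of `M` that generates a vector field vanishing at a point of the level
set is zero. -/
theorem eq_zero_of_sum_eq_zero_off_zeros (hθ : LinearIndependent ℤ θ) (hY : IsSmooth θ α β)
    {p : HSpace d} (hp : p ∈ levelSet θ α β) (a : Fin m → ℝ)
    (h : ∀ i, ¬ (p.1 i = 0 ∧ p.2 i = 0) → ∑ k, a k * (θ k i : ℝ) = 0) : a = 0 := by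
  have hξ : ∀ i, ∑ k, a k * (θ k i : ℝ) = 0 := by
    intro i
    refine eq_zero_of_forall_exp_eq_one fun t => ?_
    -- The one-parameter subgroup generated by `a` rotates only coordinates at which `p` vanishes,
    -- so it fixes `p`.
    have hfix : torusAct (fun i => Circle.exp (t * ∑ k, a k * θ k i)) p = p := by
      have hj : ∀ j, p.1 j = 0 ∧ p.2 j = 0 ∨ Circle.exp (t * ∑ k, a k * θ k j) = 1 := fun j => by
        by_cases hj : p.1 j = 0 ∧ p.2 j = 0
        · exact Or.inl hj
        · right
          rw [h j hj, mul_zero, Circle.exp_zero]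
      ext j <;> rcases hj j with hj | hj <;> simp only [torusAct, hj] <;> simp
    have := hY _ (exp_mem_subtorus θ a t) p hp hfix
    exact congrFun this i
  exact eq_zero_of_sum_eq_zero hθ a hξ

/-- If no non-zero element of `𝔪` is supported on `Z`, every element of `𝔪^*` is the restriction of
a functional that vanishes on `Z`. -/
theorem exists_weights_of_injective (Z : Fin d → Prop)
    (hZ : ∀ a : Fin m → ℝ, (∀ i, ¬ Z i → ∑ k, a k * (θ k i : ℝ) = 0) → a = 0) (s : Fin m → ℝ) :
    ∃ c : Fin d → ℝ, (∀ i, Z i → c i = 0) ∧ ∀ k, ∑ i, c i * (θ k i : ℝ) = s k := by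
  classical
  let L : (Fin m → ℝ) →ₗ[ℝ] (Fin d → ℝ) :=
    { toFun := fun a i => if Z i then 0 else ∑ k, a k * (θ k i : ℝ)
      map_add' := by
        intro a b; funext i
        simp only [Pi.add_apply, add_mul, Finset.sum_add_distrib]
        split_ifs <;> simp
      map_smul' := by
        intro r a; funext i
        simp only [Pi.smul_apply, smul_eq_mul, mul_assoc, ← Finset.mul_sum, RingHom.id_apply]
        split_ifs <;> simp }
  let R : (Fin d → ℝ) →ₗ[ℝ] (Fin m → ℝ) :=
    { toFun := fun c k => ∑ i, c i * (θ k i : ℝ)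
      map_add' := by
        intro a b; funext i
        simp only [Pi.add_apply, add_mul, Finset.sum_add_distrib]
      map_smul' := by
        intro r a; funext i
        simp only [Pi.smul_apply, smul_eq_mul, mul_assoc, Finset.mul_sum, RingHom.id_apply] }
  -- `R ∘ L` is a Gram map: pairing `R (L a)` with `a` gives `∑ (L a)_i²`. It is therefore
  -- injective, hence bijective, and the values of `L` vanish on `Z`.
  have hinj : Function.Injective (R ∘ₗ L) := by
    rw [← LinearMap.ker_eq_bot, LinearMap.ker_eq_bot']
    intro a ha
    refine hZ a fun i hi => ?_
    have h0 : ∑ i, L a i * L a i = 0 := by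
      have h1 : ∑ k, a k * (R (L a)) k = 0 := by
        have : R (L a) = 0 := ha
        simp [this]
      rw [← h1]
      simp only [R, LinearMap.coe_mk, AddHom.coe_mk, Finset.mul_sum]
      rw [Finset.sum_comm]
      refine Finset.sum_congr rfl fun i _ => ?_
      have : ∀ k, a k * (L a i * (θ k i : ℝ)) = L a i * (a k * (θ k i : ℝ)) := fun k => by ring
      simp only [this, ← Finset.mul_sum]
      by_cases hi : Z i
      · simp [L, hi]
      · simp [L, hi]
    have h2 := (Finset.sum_eq_zero_iff_of_nonneg (fun i _ => mul_self_nonneg (L a i))).1 h0 i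
      (Finset.mem_univ i)
    have h3 : L a i = 0 := by simpa using h2
    simpa [L, hi] using h3
  obtain ⟨a, ha⟩ := LinearMap.injective_iff_surjective.1 hinj s
  exact ⟨L a, fun i hi => by simp [L, hi], fun k => congrFun ha k⟩

/-- Every element of `𝔪^*` is the restriction of a functional supported on the non-zero
coordinates of a point of the level set. -/
theorem exists_real_weights (hθ : LinearIndependent ℤ θ) (hY : IsSmooth θ α β)
    {p : HSpace d} (hp : p ∈ levelSet θ α β) (s : Fin m → ℝ) :
    ∃ c : Fin d → ℝ, (∀ i, p.1 i = 0 ∧ p.2 i = 0 → c i = 0) ∧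
      ∀ k, ∑ i, c i * (θ k i : ℝ) = s k :=
  exists_weights_of_injective _ (eq_zero_of_sum_eq_zero_off_zeros hθ hY hp) s

/-- `ι^*` as a linear map. -/
def iotaStarLin (θ : Fin m → Fin d → ℤ) : (Fin d → ℂ) →ₗ[ℂ] (Fin m → ℂ) where
  toFun := iotaStar θ
  map_add' x y := by
    funext k; simp [iotaStar, add_mul, Finset.sum_add_distrib]
  map_smul' r x := by
    funext k; simp [iotaStar, mul_assoc, Finset.mul_sum]

@[simp] theorem iotaStarLin_apply (y : Fin d → ℂ) : iotaStarLin θ y = iotaStar θ y := rfl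

/-- Complex version of `exists_real_weights`. -/
theorem exists_complex_weights (hθ : LinearIndependent ℤ θ) (hY : IsSmooth θ α β)
    {p : HSpace d} (hp : p ∈ levelSet θ α β) (s : Fin m → ℂ) :
    ∃ c : Fin d → ℂ, (∀ i, p.1 i = 0 ∧ p.2 i = 0 → c i = 0) ∧ iotaStar θ c = s := by
  obtain ⟨c, hc, hc'⟩ := exists_real_weights hθ hY hp fun k => (s k).re
  obtain ⟨e, he, he'⟩ := exists_real_weights hθ hY hp fun k => (s k).im
  refine ⟨fun i => c i + e i * Complex.I, fun i hi => by simp [hc i hi, he i hi], ?_⟩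
  funext k
  have h1 := hc' k
  have h2 := he' k
  apply Complex.ext
  · rw [← h1]; simp [iotaStar]
  · rw [← h2]; simp [iotaStar]

/-! ### The differentials of the moment maps -/

/-- The combination `z̄_i ż_i - w̄_i ẇ_i`, whose real part is the differential of
`½ (|z_i|² - |w_i|²)` and whose imaginary part is the inner product with the torus direction. -/
def conjDiff (p : HSpace d) : HSpace d →ₗ[ℂ] (Fin d → ℂ) where
  toFun v i := star (p.1 i) * v.1 i - star (p.2 i) * v.2 i
  map_add' u v := by funext i; simp; ring
  map_smul' r v := by funext i; simp; ring

/-- The differential `w_i ż_i + z_i ẇ_i` of `z_i w_i`. -/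
def prodDiff (p : HSpace d) : HSpace d →ₗ[ℂ] (Fin d → ℂ) where
  toFun v i := p.2 i * v.1 i + p.1 i * v.2 i
  map_add' u v := by funext i; simp; ring
  map_smul' r v := by funext i; simp; ring

theorem conjDiff_apply (p v : HSpace d) (i : Fin d) :
    conjDiff p v i = star (p.1 i) * v.1 i - star (p.2 i) * v.2 i := rfl

theorem prodDiff_apply (p v : HSpace d) (i : Fin d) :
    prodDiff p v i = p.2 i * v.1 i + p.1 i * v.2 i := rfl

/-- Coordinatewise products `(z, w) ↦ (z_i w_i)_i`. -/
def coordProd (p : HSpace d) : Fin d → ℂ := fun i => p.1 i * p.2 i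

theorem contDiff_fst_apply (i : Fin d) : ContDiff ℝ ∞ (fun q : HSpace d => q.1 i) :=
  (contDiff_apply ℝ ℂ i).comp contDiff_fst

theorem contDiff_snd_apply (i : Fin d) : ContDiff ℝ ∞ (fun q : HSpace d => q.2 i) :=
  (contDiff_apply ℝ ℂ i).comp contDiff_snd

theorem contDiff_coordProd : ContDiff ℝ ∞ (coordProd : HSpace d → Fin d → ℂ) :=
  contDiff_pi.2 fun i => (contDiff_fst_apply i).mul (contDiff_snd_apply i)

theorem contDiff_muR : ContDiff ℝ ∞ (muR θ) :=
  contDiff_pi.2 fun _ => contDiff_const.mul <| ContDiff.sum fun i _ =>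
    (((contDiff_fst_apply i).norm_sq ℝ).sub ((contDiff_snd_apply i).norm_sq ℝ)).mul contDiff_const

theorem contDiff_muC : ContDiff ℝ ∞ (muC θ) := by
  refine contDiff_pi.2 fun _ => ?_
  simp only [muC, iotaStar]
  exact ContDiff.sum fun i _ =>
    ((contDiff_fst_apply i).mul (contDiff_snd_apply i)).mul contDiff_const

/-- Once smoothness is known, a differential can be read off from one-variable derivatives; the
moment maps and their lifts are differentiated this way. -/
theorem fderiv_eq_of_line {E F : Type*} [NormedAddCommGroup E] [NormedSpace ℝ E]
    [NormedAddCommGroup F] [NormedSpace ℝ F] {f : E → F} {p v : E} {D : F}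
    (hf : DifferentiableAt ℝ f p) (h : HasDerivAt (fun t : ℝ => f (p + t • v)) D 0) :
    fderiv ℝ f p v = D := by
  have h1 : HasLineDerivAt ℝ f (fderiv ℝ f p v) p v := hf.hasFDerivAt.hasLineDerivAt v
  exact HasDerivAt.unique h1 h

theorem hasDerivAt_fst_line (p v : HSpace d) (i : Fin d) :
    HasDerivAt (fun t : ℝ => (p + t • v).1 i) (v.1 i) 0 := by
  simpa using ((hasDerivAt_id (0 : ℝ)).smul_const (v.1 i)).const_add (p.1 i)

theorem hasDerivAt_snd_line (p v : HSpace d) (i : Fin d) :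
    HasDerivAt (fun t : ℝ => (p + t • v).2 i) (v.2 i) 0 := by
  simpa using ((hasDerivAt_id (0 : ℝ)).smul_const (v.2 i)).const_add (p.2 i)

theorem fderiv_coordProd (p v : HSpace d) : fderiv ℝ coordProd p v = prodDiff p v := by
  refine fderiv_eq_of_line (contDiff_coordProd.contDiffAt.differentiableAt (by simp)) ?_
  refine hasDerivAt_pi.2 fun i => ?_
  refine ((hasDerivAt_fst_line p v i).mul (hasDerivAt_snd_line p v i)).congr_deriv ?_
  simp [prodDiff_apply]
  ring

theorem fderiv_muC (p v : HSpace d) : fderiv ℝ (muC θ) p v = iotaStar θ (prodDiff p v) := by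
  refine fderiv_eq_of_line (contDiff_muC.contDiffAt.differentiableAt (by simp)) ?_
  refine hasDerivAt_pi.2 fun k => ?_
  simp only [muC, iotaStar]
  refine (HasDerivAt.fun_sum fun i _ =>
    ((hasDerivAt_fst_line p v i).mul (hasDerivAt_snd_line p v i)).mul_const
      (θ k i : ℂ)).congr_deriv ?_
  refine Finset.sum_congr rfl fun i _ => ?_
  simp only [zero_smul, add_zero, prodDiff_apply]
  ring

theorem fderiv_muR (p v : HSpace d) (k : Fin m) :
    fderiv ℝ (muR θ) p v k = (iotaStar θ (conjDiff p v) k).re := by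
  have : fderiv ℝ (muR θ) p v = fun k => (iotaStar θ (conjDiff p v) k).re := by
    refine fderiv_eq_of_line (contDiff_muR.contDiffAt.differentiableAt (by simp)) ?_
    refine hasDerivAt_pi.2 fun k => ?_
    refine ((HasDerivAt.fun_sum fun i _ =>
      (((hasDerivAt_fst_line p v i).norm_sq).sub ((hasDerivAt_snd_line p v i).norm_sq)).mul_const
        (θ k i : ℝ)).const_mul (1 / 2 : ℝ)).congr_deriv ?_
    rw [iotaStar, Complex.re_sum, Finset.mul_sum]
    refine Finset.sum_congr rfl fun i _ => ?_
    simp [conjDiff_apply, Complex.inner]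
    ring
  rw [this]

theorem metric_infinitesimal (ξ : Fin d → ℝ) (p v : HSpace d) :
    metric (infinitesimal ξ p) v = ∑ i, ξ i * (conjDiff p v i).im := by
  refine Finset.sum_congr rfl fun i _ => ?_
  simp [infinitesimal, conjDiff_apply]
  ring

theorem forall_metric_infinitesimal_eq_zero_iff (p v : HSpace d) :
    (∀ ξ ∈ lieM θ, metric (infinitesimal ξ p) v = 0) ↔
      ∀ k, (iotaStar θ (conjDiff p v) k).im = 0 := by
  have key : ∀ k, metric (infinitesimal (fun i => (θ k i : ℝ)) p) v =
      (iotaStar θ (conjDiff p v) k).im := by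
    intro k
    rw [metric_infinitesimal, iotaStar, Complex.im_sum]
    refine Finset.sum_congr rfl fun i _ => ?_
    simp [mul_comm]
  constructor
  · intro h k
    rw [← key]
    exact h _ (Submodule.subset_span ⟨k, rfl⟩)
  · intro h ξ hξ
    induction hξ using Submodule.span_induction with
    | mem x hx => obtain ⟨k, rfl⟩ := hx; rw [key, h]
    | zero => simp [metric_infinitesimal]
    | add x y _ _ hx hy =>
      rw [metric_infinitesimal] at *
      simp [add_mul, Finset.sum_add_distrib, hx, hy]
    | smul a x _ hx =>
      rw [metric_infinitesimal] at *
      simp [mul_assoc, ← Finset.mul_sum, hx]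

/-- Vanishing of `dμ_ℝ` and orthogonality to the orbit are the real and imaginary parts of a single
complex-linear equation. This makes the horizontal space stable under `I₁`. -/
theorem mem_tangentY_iff (p v : HSpace d) :
    v ∈ tangentY θ p ↔
      iotaStar θ (conjDiff p v) = 0 ∧ iotaStar θ (prodDiff p v) = 0 := by
  change (fderiv ℝ (muR θ) p v = 0 ∧ fderiv ℝ (muC θ) p v = 0 ∧
    ∀ ξ ∈ lieM θ, metric (infinitesimal ξ p) v = 0) ↔ _
  rw [forall_metric_infinitesimal_eq_zero_iff, fderiv_muC]
  constructor
  · rintro ⟨h1, h2, h3⟩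
    refine ⟨?_, h2⟩
    funext k
    exact Complex.ext (by rw [← fderiv_muR, h1]; rfl) (h3 k)
  · rintro ⟨h1, h2⟩
    refine ⟨?_, h2, fun k => by rw [h1]; rfl⟩
    funext k
    rw [fderiv_muR, h1]; rfl

theorem norm_sq_add_norm_sq_ne_zero {z w : ℂ} (h : ¬ (z = 0 ∧ w = 0)) :
    z * star z + w * star w ≠ 0 := by
  intro h0
  have h1 : ((Complex.normSq z + Complex.normSq w : ℝ) : ℂ) = 0 := by
    rw [← h0]; simp [Complex.mul_conj]
  have h2 : Complex.normSq z + Complex.normSq w = 0 := by exact_mod_cast h1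
  have h3 := Complex.normSq_nonneg z
  have h4 := Complex.normSq_nonneg w
  exact h ⟨Complex.normSq_eq_zero.1 (by linarith), Complex.normSq_eq_zero.1 (by linarith)⟩

/-- Vectors with prescribed `conjDiff` and `prodDiff`, supported on the non-zero coordinates. -/
theorem exists_conjDiff_prodDiff (p : HSpace d) (c e : Fin d → ℂ)
    (hc : ∀ i, p.1 i = 0 ∧ p.2 i = 0 → c i = 0) (he : ∀ i, p.1 i = 0 ∧ p.2 i = 0 → e i = 0) :
    ∃ v : HSpace d, conjDiff p v = c ∧ prodDiff p v = e := by
  -- Cramer's rule for the system `z̄ a - w̄ b = c`, `w a + z b = e`, of determinant `|z|² + |w|²`.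
  -- Where the determinant vanishes, both sides of the system are zero.
  refine ⟨(fun i => (p.1 i * c i + star (p.2 i) * e i) /
      (p.1 i * star (p.1 i) + p.2 i * star (p.2 i)),
    fun i => (star (p.1 i) * e i - p.2 i * c i) /
      (p.1 i * star (p.1 i) + p.2 i * star (p.2 i))), ?_, ?_⟩
  all_goals
    funext i
    by_cases hi : p.1 i = 0 ∧ p.2 i = 0
    · simp [conjDiff_apply, prodDiff_apply, hi, hc i hi, he i hi]
    · have := norm_sq_add_norm_sq_ne_zero hi
      simp only [conjDiff_apply, prodDiff_apply, ← mul_div_assoc, ← sub_div, ← add_div]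
      rw [div_eq_iff this]
      ring

/-- The defining equations of the horizontal space. -/
def horizontalEq (θ : Fin m → Fin d → ℤ) (p : HSpace d) :
    HSpace d →ₗ[ℂ] (Fin m → ℂ) × (Fin m → ℂ) :=
  ((iotaStarLin θ).comp (conjDiff p)).prod ((iotaStarLin θ).comp (prodDiff p))

theorem horizontalEq_surjective (hθ : LinearIndependent ℤ θ) (hY : IsSmooth θ α β)
    {p : HSpace d} (hp : p ∈ levelSet θ α β) : Function.Surjective (horizontalEq θ p) := by
  rintro ⟨r, s⟩
  obtain ⟨c, hc, rfl⟩ := exists_complex_weights hθ hY hp r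
  obtain ⟨e, he, rfl⟩ := exists_complex_weights hθ hY hp s
  obtain ⟨v, rfl, rfl⟩ := exists_conjDiff_prodDiff p c e hc he
  exact ⟨v, rfl⟩

theorem tangentY_eq (p : HSpace d) :
    tangentY θ p = (LinearMap.ker (horizontalEq θ p)).restrictScalars ℝ := by
  ext v
  rw [mem_tangentY_iff]
  simp [horizontalEq]

/-- There are `2m` independent complex equations on `ℂ^{2d}`, leaving complex dimension `2n`. -/
theorem finrank_tangentY {n : ℕ} (hd : m + n = d) (hθ : LinearIndependent ℤ θ)
    (hY : IsSmooth θ α β) {p : HSpace d} (hp : p ∈ levelSet θ α β) :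
    Module.finrank ℝ (tangentY θ p) = 4 * n := by
  have h1 := (horizontalEq θ p).finrank_range_add_finrank_ker
  rw [LinearMap.range_eq_top.2 (horizontalEq_surjective hθ hY hp), finrank_top] at h1
  simp only [Module.finrank_prod, Module.finrank_fin_fun] at h1
  have h2 : Module.finrank ℝ (tangentY θ p) =
      2 * Module.finrank ℂ (LinearMap.ker (horizontalEq θ p)) := by
    rw [tangentY_eq]
    exact finrank_real_of_complex (LinearMap.ker (horizontalEq θ p))
  omega

/-! ### Curves with prescribed real moment map and constant coordinate products -/

/-- The norm of `z` when `z w = y` and `‖z‖² - ‖w‖² = a`. -/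
def branchNorm (y : ℂ) (a : ℝ) : ℝ := √((a + √(a ^ 2 + 4 * ‖y‖ ^ 2)) / 2)

theorem continuous_branchNorm (y : ℂ) : Continuous (branchNorm y) := by
  unfold branchNorm
  fun_prop

theorem abs_le_sqrt_sq_add (y : ℂ) (a : ℝ) : |a| ≤ √(a ^ 2 + 4 * ‖y‖ ^ 2) :=
  Real.abs_le_sqrt (by nlinarith [sq_nonneg ‖y‖])

theorem branchNorm_sq (y : ℂ) (a : ℝ) :
    branchNorm y a ^ 2 = (a + √(a ^ 2 + 4 * ‖y‖ ^ 2)) / 2 := by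
  have := (neg_abs_le a).trans' (neg_le_neg (abs_le_sqrt_sq_add y a))
  exact Real.sq_sqrt (by linarith)

/-- `‖z‖²` and `-‖w‖²` are the two roots of `X² - a X - ‖y‖²`. Exchanging `z` and `w` changes the
sign of `a`, so `branchNorm y (-a)` is the norm of `w`. -/
theorem branchNorm_sq_sub (y : ℂ) (a : ℝ) :
    branchNorm y a ^ 2 - branchNorm y (-a) ^ 2 = a := by
  rw [branchNorm_sq, branchNorm_sq, neg_sq]
  ring

theorem branchNorm_nonneg (y : ℂ) (a : ℝ) : 0 ≤ branchNorm y a := Real.sqrt_nonneg _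

theorem branchNorm_mul (y : ℂ) (a : ℝ) : branchNorm y a * branchNorm y (-a) = ‖y‖ := by
  have h : (branchNorm y a * branchNorm y (-a)) ^ 2 = ‖y‖ ^ 2 := by
    rw [mul_pow, branchNorm_sq, branchNorm_sq, neg_sq]
    have := Real.sq_sqrt (show 0 ≤ a ^ 2 + 4 * ‖y‖ ^ 2 by positivity)
    nlinarith
  exact (sq_eq_sq₀ (mul_nonneg (branchNorm_nonneg _ _) (branchNorm_nonneg _ _))
    (norm_nonneg _)).1 h

theorem branchNorm_mul_self (z w : ℂ) : branchNorm (z * w) (‖z‖ ^ 2 - ‖w‖ ^ 2) = ‖z‖ := by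
  have h : (‖z‖ ^ 2 - ‖w‖ ^ 2) ^ 2 + 4 * ‖z * w‖ ^ 2 = (‖z‖ ^ 2 + ‖w‖ ^ 2) ^ 2 := by
    rw [norm_mul]; ring
  rw [branchNorm, h, Real.sqrt_sq (by positivity)]
  rw [show (‖z‖ ^ 2 - ‖w‖ ^ 2 + (‖z‖ ^ 2 + ‖w‖ ^ 2)) / 2 = ‖z‖ ^ 2 by ring,
    Real.sqrt_sq (norm_nonneg _)]

theorem branchNorm_zero_of_nonneg {a : ℝ} (ha : 0 ≤ a) : branchNorm 0 a = √a := by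
  rw [branchNorm]
  congr 1
  simp [Real.sqrt_sq ha]

theorem branchNorm_zero_of_nonpos {a : ℝ} (ha : a ≤ 0) : branchNorm 0 a = 0 := by
  rw [branchNorm, norm_zero]
  simp [Real.sqrt_sq_eq_abs, abs_of_nonpos ha]

/-- The excluded case is `z = w = 0`: there the function is `√(max a 0)`, which is singular at `0`.
-/
theorem differentiableAt_branchNorm {y : ℂ} {a : ℝ} (h : ¬ (y = 0 ∧ a = 0)) :
    DifferentiableAt ℝ (branchNorm y) a := by
  by_cases hy : y = 0
  · subst hy
    have ha : a ≠ 0 := fun h0 => h ⟨rfl, h0⟩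
    rcases lt_or_gt_of_ne ha with ha | ha
    · refine (differentiableAt_const (0 : ℝ)).congr_of_eventuallyEq ?_
      filter_upwards [Iio_mem_nhds ha] with x hx using branchNorm_zero_of_nonpos (le_of_lt hx)
    · refine (Real.hasDerivAt_sqrt ha.ne').differentiableAt.congr_of_eventuallyEq ?_
      filter_upwards [Ioi_mem_nhds ha] with x hx using branchNorm_zero_of_nonneg (le_of_lt hx)
  · have hy' : 0 < ‖y‖ := norm_pos_iff.2 hy
    have h1 : a ^ 2 + 4 * ‖y‖ ^ 2 ≠ 0 := by positivity
    have h2 : |a| < √(a ^ 2 + 4 * ‖y‖ ^ 2) :=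
      Real.lt_sqrt_of_sq_lt (by rw [sq_abs]; nlinarith)
    have h3 : (a + √(a ^ 2 + 4 * ‖y‖ ^ 2)) / 2 ≠ 0 := by
      have := neg_abs_le a
      intro h0
      linarith
    unfold branchNorm
    have h4 : DifferentiableAt ℝ (fun x : ℝ => x ^ 2 + 4 * ‖y‖ ^ 2) a := by fun_prop
    exact ((differentiableAt_fun_id.add (h4.sqrt h1)).div_const 2).sqrt h3

/-- The phase of a complex number (`1` for `0`). -/
def phase (z : ℂ) : ℂ := if z = 0 then 1 else z / ‖z‖

theorem norm_phase (z : ℂ) : ‖phase z‖ = 1 := by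
  unfold phase
  split_ifs with h
  · simp
  · rw [norm_div, Complex.norm_real, norm_norm, div_self (norm_ne_zero_iff.2 h)]

theorem norm_mul_phase (z : ℂ) : ‖z‖ * phase z = z := by
  unfold phase
  split_ifs with h
  · simp [h]
  · rw [mul_div_cancel₀]
    exact_mod_cast norm_ne_zero_iff.2 h

/-- The curve through `p` with constant products `z_i w_i` along which `|z_i|² - |w_i|²` grows
with speed `u_i`. -/
def momentCurve (p : HSpace d) (u : Fin d → ℝ) (s : ℝ) : HSpace d :=
  (fun i => branchNorm (p.1 i * p.2 i) (‖p.1 i‖ ^ 2 - ‖p.2 i‖ ^ 2 + s * u i) * phase (p.1 i),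
    fun i => branchNorm (p.1 i * p.2 i) (-(‖p.1 i‖ ^ 2 - ‖p.2 i‖ ^ 2 + s * u i)) * phase (p.2 i))

theorem continuous_momentCurve (p : HSpace d) (u : Fin d → ℝ) : Continuous (momentCurve p u) := by
  refine Continuous.prodMk (continuous_pi fun i => ?_) (continuous_pi fun i => ?_)
  · exact (Complex.continuous_ofReal.comp
      ((continuous_branchNorm _).comp (by fun_prop))).mul continuous_const
  · exact (Complex.continuous_ofReal.comp
      ((continuous_branchNorm _).comp (by fun_prop))).mul continuous_const

theorem branchNorm_neg_self (z w : ℂ) :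
    branchNorm (z * w) (-(‖z‖ ^ 2 - ‖w‖ ^ 2)) = ‖w‖ := by
  rw [neg_sub, mul_comm, branchNorm_mul_self]

theorem momentCurve_zero (p : HSpace d) (u : Fin d → ℝ) : momentCurve p u 0 = p := by
  ext i
  · simp only [momentCurve, zero_mul, add_zero, branchNorm_mul_self, norm_mul_phase]
  · simp only [momentCurve, zero_mul, add_zero, branchNorm_neg_self, norm_mul_phase]

theorem coordProd_momentCurve (p : HSpace d) (u : Fin d → ℝ) (s : ℝ) :
    coordProd (momentCurve p u s) = coordProd p := by
  funext i
  have h := branchNorm_mul (p.1 i * p.2 i) (‖p.1 i‖ ^ 2 - ‖p.2 i‖ ^ 2 + s * u i)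
  simp only [momentCurve, coordProd]
  rw [mul_mul_mul_comm, ← Complex.ofReal_mul, h, norm_mul, Complex.ofReal_mul,
    mul_mul_mul_comm, norm_mul_phase, norm_mul_phase]

theorem norm_sq_sub_momentCurve (p : HSpace d) (u : Fin d → ℝ) (s : ℝ) (i : Fin d) :
    ‖(momentCurve p u s).1 i‖ ^ 2 - ‖(momentCurve p u s).2 i‖ ^ 2 =
      ‖p.1 i‖ ^ 2 - ‖p.2 i‖ ^ 2 + s * u i := by
  simp only [momentCurve, norm_mul, norm_phase, mul_one, Complex.norm_real, Real.norm_eq_abs,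
    sq_abs, branchNorm_sq_sub]

theorem muR_momentCurve (p : HSpace d) (u : Fin d → ℝ) (s : ℝ) (k : Fin m) :
    muR θ (momentCurve p u s) k = muR θ p k + s / 2 * ∑ i, u i * (θ k i : ℝ) := by
  simp only [muR, norm_sq_sub_momentCurve, add_mul, Finset.sum_add_distrib, mul_add, mul_assoc,
    ← Finset.mul_sum]
  ring

theorem muC_eq_iotaStar_coordProd (p : HSpace d) : muC θ p = iotaStar θ (coordProd p) := rfl

theorem momentCurve_mem_levelSet {p : HSpace d} (hp : p ∈ levelSet θ α β) {u : Fin d → ℝ}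
    (hu : ∀ k, ∑ i, u i * (θ k i : ℝ) = 0) (s : ℝ) : momentCurve p u s ∈ levelSet θ α β := by
  refine ⟨?_, ?_⟩
  · funext k
    rw [muR_momentCurve, hu, mul_zero, add_zero, hp.1]
  · rw [muC_eq_iotaStar_coordProd, coordProd_momentCurve]
    exact hp.2

/-- The substitution `s = t²` stops the motion to first order at regular coordinates, while it turns
the singular growth `√s` at zero coordinates into unit speed. -/
theorem hasDerivAt_branchNorm_sq {y : ℂ} {a : ℝ} (h : ¬ (y = 0 ∧ a = 0)) (u : ℝ) :
    HasDerivAt (fun t : ℝ => branchNorm y (a + t ^ 2 * u)) 0 0 := by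
  have h1 : HasDerivAt (fun t : ℝ => a + t ^ 2 * u) 0 0 := by
    simpa using (((hasDerivAt_id (0 : ℝ)).pow 2).mul_const u).const_add a
  have h2 : HasDerivAt (branchNorm y) (deriv (branchNorm y) a) (a + 0 ^ 2 * u) := by
    simpa using (differentiableAt_branchNorm h).hasDerivAt
  simpa [Function.comp_def] using h2.comp (0 : ℝ) h1

theorem moment_ne_zero {z w : ℂ} (h : ¬ (z = 0 ∧ w = 0)) :
    ¬ (z * w = 0 ∧ ‖z‖ ^ 2 - ‖w‖ ^ 2 = 0) := by
  rintro ⟨h1, h2⟩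
  rcases mul_eq_zero.1 h1 with h0 | h0 <;> simp [h0] at h2 <;>
    exact h ⟨by simp [h0, h2], by simp [h0, h2]⟩

/-- At a zero coordinate `z_i = √(t²) = t` and `w_i = 0` for `t ≥ 0`; the velocity is exactly `1`
because `phase 0 = 1`. The derivative is one-sided because `√(t²) = |t|` has a corner. -/
theorem hasDerivWithinAt_momentCurve_pos (p : HSpace d) (u : Fin d → ℝ)
    (hu : ∀ i, p.1 i = 0 ∧ p.2 i = 0 → u i = 1) :
    HasDerivWithinAt (fun t => momentCurve p u (t ^ 2))
      ((fun i => if p.1 i = 0 ∧ p.2 i = 0 then 1 else 0, 0) : HSpace d) (Set.Ici 0) 0 := by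
  refine HasDerivWithinAt.prodMk (hasDerivWithinAt_pi.2 fun i => ?_)
    (hasDerivWithinAt_pi.2 fun i => ?_)
  · split_ifs with hi
    · have h1 : HasDerivWithinAt (fun t : ℝ => (t : ℂ)) 1 (Set.Ici 0) 0 :=
        (Complex.ofRealCLM.hasDerivAt (x := (0 : ℝ))).hasDerivWithinAt
      refine h1.congr_of_mem (fun t ht => ?_) Set.self_mem_Ici
      simp only [hi, hu i hi, phase]
      simp [branchNorm_zero_of_nonneg (sq_nonneg t), Real.sqrt_sq (Set.mem_Ici.1 ht)]
    · have := ((hasDerivAt_branchNorm_sq (moment_ne_zero hi) (u i)).ofReal_comp.mul_const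
        (phase (p.1 i))).hasDerivWithinAt (s := Set.Ici 0)
      simpa using this
  · by_cases hi : p.1 i = 0 ∧ p.2 i = 0
    · refine (hasDerivWithinAt_const (0 : ℝ) (Set.Ici 0) (0 : ℂ)).congr_of_mem (fun t ht => ?_)
        Set.self_mem_Ici
      simp only [hi, hu i hi, phase]
      simp [branchNorm_zero_of_nonpos (neg_nonpos.2 (sq_nonneg t))]
    · have hi' : ¬ (p.1 i * p.2 i = 0 ∧ -(‖p.1 i‖ ^ 2 - ‖p.2 i‖ ^ 2) = 0) := by
        rw [neg_eq_zero]; exact moment_ne_zero hi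
      have := ((hasDerivAt_branchNorm_sq hi' (-u i)).ofReal_comp.mul_const
        (phase (p.2 i))).hasDerivWithinAt (s := Set.Ici 0)
      have e : ∀ t : ℝ, -(‖p.1 i‖ ^ 2 - ‖p.2 i‖ ^ 2 + t ^ 2 * u i) =
        -(‖p.1 i‖ ^ 2 - ‖p.2 i‖ ^ 2) + t ^ 2 * -u i := fun t => by ring
      simp only [e]
      simpa using this

/-- Exchanging `z` and `w`. -/
theorem momentCurve_swap (p : HSpace d) (u : Fin d → ℝ) (s : ℝ) :
    momentCurve p.swap (-u) s = (momentCurve p u s).swap := by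
  ext i <;> simp only [momentCurve, Prod.fst_swap, Prod.snd_swap, Pi.neg_apply] <;>
    rw [mul_comm (p.2 i)] <;> congr 3 <;> ring

theorem hasDerivWithinAt_momentCurve_neg (p : HSpace d) (u : Fin d → ℝ)
    (hu : ∀ i, p.1 i = 0 ∧ p.2 i = 0 → u i = -1) :
    HasDerivWithinAt (fun t => momentCurve p u (t ^ 2))
      ((0, fun i => if p.1 i = 0 ∧ p.2 i = 0 then 1 else 0) : HSpace d) (Set.Ici 0) 0 := by
  have h := hasDerivWithinAt_momentCurve_pos p.swap (-u) (fun i hi => by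
    simp [hu i ⟨hi.2, hi.1⟩])
  simp only [momentCurve_swap] at h
  have h1 := (ContinuousLinearEquiv.prodComm ℝ (Fin d → ℂ) (Fin d → ℂ)).toContinuousLinearMap
    |>.hasFDerivAt.comp_hasDerivWithinAt (0 : ℝ) h
  simpa [Function.comp_def, and_comm] using h1

/-! ### The residual moment map -/

theorem residualMuC_toY_mk (lam : Fin d → ℂ) (hlam : iotaStar θ lam = β) (p : levelSet θ α β)
    (x : Fin d → ℝ) :
    residualMuC θ α β lam hlam (toY p) (Submodule.Quotient.mk x) =
      ∑ i, (x i : ℂ) * (coordProd p.1 i - lam i) := by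
  change ((lieM θ).liftQ _ _) (Submodule.Quotient.mk x) = _
  rw [Submodule.liftQ_apply, LinearMap.sum_apply]
  simp [coordProd]

theorem nStarC_mk (b : NStarC θ) (x : Fin d → ℝ) :
    b (Submodule.Quotient.mk x) =
      ∑ i, (x i : ℂ) * b (Submodule.Quotient.mk (Pi.single i 1)) := by
  have h := (b ∘ₗ (lieM θ).mkQ).pi_apply_eq_sum_univ x
  simp only [LinearMap.comp_apply, Submodule.mkQ_apply] at h
  rw [h]
  refine Finset.sum_congr rfl fun i _ => ?_
  rw [Complex.real_smul]
  congr 4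
  funext j
  simp [Pi.single_apply, eq_comm]

/-- A functional on `𝔫` is determined by its values on the classes of the `e_i`, so the fiber fixes
each product `z_i w_i` separately. -/
theorem mem_fiber_iff (lam : Fin d → ℂ) (hlam : iotaStar θ lam = β) (b : NStarC θ)
    (p : levelSet θ α β) :
    toY p ∈ residualMuC θ α β lam hlam ⁻¹' {b} ↔
      coordProd p.1 = fun i => lam i + b (Submodule.Quotient.mk (Pi.single i 1)) := by
  rw [Set.mem_preimage, Set.mem_singleton_iff]
  constructor
  · intro h
    funext i
    have h1 := residualMuC_toY_mk lam hlam p (Pi.single i 1)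
    rw [h] at h1
    rw [h1, Finset.sum_eq_single i (fun j _ hj => by simp [hj]) (by simp)]
    simp
  · intro h
    apply LinearMap.ext
    intro ξ
    obtain ⟨x, rfl⟩ := Submodule.Quotient.mk_surjective _ ξ
    rw [residualMuC_toY_mk, nStarC_mk b, h]
    simp

theorem iotaStar_nStarC (b : NStarC θ) :
    iotaStar θ (fun i => b (Submodule.Quotient.mk (Pi.single i 1))) = 0 := by
  funext k
  have h := nStarC_mk b fun i => (θ k i : ℝ)
  have hk : (fun i => (θ k i : ℝ)) ∈ lieM θ := Submodule.subset_span ⟨k, rfl⟩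
  rw [(Submodule.Quotient.mk_eq_zero _).2 hk, map_zero] at h
  simp only [iotaStar, Pi.zero_apply]
  rw [h]
  exact Finset.sum_congr rfl fun i _ => by push_cast; ring

theorem finrank_lieN {n : ℕ} (hd : m + n = d) (hθ : LinearIndependent ℤ θ) :
    Module.finrank ℝ (LieN θ) = n := by
  have h1 := (lieM θ).finrank_quotient_add_finrank
  have h2 : Module.finrank ℝ (lieM θ) = m := by
    rw [lieM, finrank_span_eq_card (linearIndependent_real hθ), Fintype.card_fin]
  rw [h2, Module.finrank_fin_fun] at h1
  change Module.finrank ℝ ((Fin d → ℝ) ⧸ lieM θ) = n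
  omega

theorem finrank_nStarC {n : ℕ} (hd : m + n = d) (hθ : LinearIndependent ℤ θ) :
    Module.finrank ℂ (NStarC θ) = n := by
  rw [Module.finrank_linearMap, finrank_lieN hd hθ, Module.finrank_self, mul_one]

/-- The point `(y, 1)` has the required products; the real moment map is then corrected along
`momentCurve`, which preserves them. -/
theorem residualMuC_surjective (hθ : LinearIndependent ℤ θ) (lam : Fin d → ℂ)
    (hlam : iotaStar θ lam = β) : Function.Surjective (residualMuC θ α β lam hlam) := by
  intro b
  set y : Fin d → ℂ := fun i => lam i + b (Submodule.Quotient.mk (Pi.single i 1)) with hy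
  have hyβ : iotaStar θ y = β := by
    have h : iotaStarLin θ (lam + fun i => b (Submodule.Quotient.mk (Pi.single i 1))) = β := by
      rw [map_add, iotaStarLin_apply, iotaStarLin_apply, iotaStar_nStarC, add_zero, hlam]
    exact h
  let p₀ : HSpace d := (y, 1)
  have hp₀ : coordProd p₀ = y := by funext i; simp [coordProd, p₀]
  -- With no coordinate excluded, linear independence of `θ` suffices. The factor `2` cancels the `s
  -- / 2` in `muR_momentCurve` at `s = 1`.
  obtain ⟨u, -, hu⟩ := exists_weights_of_injective (θ := θ) (fun _ => False)
    (fun a ha => eq_zero_of_sum_eq_zero hθ a fun i => ha i id)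
    (fun k => 2 * (α k - muR θ p₀ k))
  have hp : momentCurve p₀ u 1 ∈ levelSet θ α β := by
    refine ⟨?_, ?_⟩
    · funext k
      rw [muR_momentCurve, hu]
      ring
    · rw [muC_eq_iotaStar_coordProd, coordProd_momentCurve, hp₀, hyβ]
  refine ⟨toY ⟨_, hp⟩, ?_⟩
  exact (mem_fiber_iff lam hlam b _).2 (by rw [coordProd_momentCurve, hp₀])

/-! ### Linear coordinates of the residual moment map are holomorphic -/

/-- A polynomial representing a coordinate of the residual moment map, shifted by `c`. -/
def residualLift (lam : Fin d → ℂ) (x : Fin d → ℝ) (c : ℂ) (q : HSpace d) : ℂ :=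
  ∑ i, (x i : ℂ) * (coordProd q i - lam i) - c

theorem contDiff_residualLift (lam : Fin d → ℂ) (x : Fin d → ℝ) (c : ℂ) :
    ContDiff ℝ ∞ (residualLift lam x c) :=
  (ContDiff.sum fun i _ => contDiff_const.mul
    (((contDiff_apply ℝ ℂ i).comp contDiff_coordProd).sub contDiff_const)).sub contDiff_const

theorem fderiv_residualLift (lam : Fin d → ℂ) (x : Fin d → ℝ) (c : ℂ) (p v : HSpace d) :
    fderiv ℝ (residualLift lam x c) p v = ∑ i, (x i : ℂ) * prodDiff p v i := by
  refine fderiv_eq_of_line ((contDiff_residualLift lam x c).contDiffAt.differentiableAt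
    (by simp)) ?_
  unfold residualLift
  refine ((HasDerivAt.fun_sum fun i _ => (((hasDerivAt_fst_line p v i).mul
    (hasDerivAt_snd_line p v i)).sub_const (lam i)).const_mul (x i : ℂ)).sub_const
      c).congr_deriv ?_
  refine Finset.sum_congr rfl fun i _ => ?_
  simp only [zero_smul, add_zero, prodDiff_apply]
  ring

theorem I₁_eq_smul (v : HSpace d) : I₁ v = Complex.I • v := rfl

theorem isHolomorphicLift_residualLift (lam : Fin d → ℂ) (hlam : iotaStar θ lam = β)
    (x : Fin d → ℝ) (c : ℂ) :
    IsHolomorphicLift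
      (fun y : Y θ α β => residualMuC θ α β lam hlam y (Submodule.Quotient.mk x) - c)
      Set.univ (residualLift lam x c) where
  isOpen := isOpen_univ
  smooth := (contDiff_residualLift lam x c).contDiffOn
  lift p _ := by rw [residualMuC_toY_mk]; rfl
  complexLinear p _ v _ := by
    rw [fderiv_residualLift, fderiv_residualLift, I₁_eq_smul, map_smul, Finset.mul_sum]
    refine Finset.sum_congr rfl fun i _ => ?_
    simp only [Pi.smul_apply, smul_eq_mul]
    ring

theorem isHolomorphicOn_residualMuC_sub (lam : Fin d → ℂ) (hlam : iotaStar θ lam = β)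
    (ξ : LieN θ) (c : ℂ) (U : Set (Y θ α β)) :
    IsHolomorphicOn (fun y : Y θ α β => residualMuC θ α β lam hlam y ξ - c) U := by
  obtain ⟨x, rfl⟩ := Submodule.Quotient.mk_surjective _ ξ
  exact fun p _ => ⟨_, _, Set.mem_univ _, isHolomorphicLift_residualLift lam hlam x c⟩

theorem isHolomorphicMap_residualMuC (lam : Fin d → ℂ) (hlam : iotaStar θ lam = β) :
    IsHolomorphicMap (residualMuC θ α β lam hlam) := fun ξ => by
  simpa using isHolomorphicOn_residualMuC_sub lam hlam ξ 0 Set.univ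

/-- One equation per `e_i` is enough here: the equations may be redundant. Independent ones, from a
basis of `𝔫`, are needed only at smooth points. -/
theorem isAnalyticSubvariety_fiber (lam : Fin d → ℂ) (hlam : iotaStar θ lam = β) (b : NStarC θ) :
    IsAnalyticSubvariety (residualMuC θ α β lam hlam ⁻¹' {b}) := by
  refine fun y => ⟨Set.univ, isOpen_univ, Set.mem_univ _, d, fun i y =>
    residualMuC θ α β lam hlam y (Submodule.Quotient.mk (Pi.single i 1)) -
      b (Submodule.Quotient.mk (Pi.single i 1)),
    fun i => isHolomorphicOn_residualMuC_sub lam hlam _ _ _, ?_⟩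
  ext x
  simp only [Set.inter_univ, Set.mem_preimage, Set.mem_singleton_iff, Set.mem_ofPred_eq,
    Set.mem_univ, true_and, sub_eq_zero]
  refine ⟨fun h i => by rw [h], fun h => LinearMap.ext fun ξ => ?_⟩
  obtain ⟨v, rfl⟩ := Submodule.Quotient.mk_surjective _ ξ
  rw [nStarC_mk b, nStarC_mk]
  simp only [h]

/-! ### Regular points of the fibers -/

/-- A point of a fiber without zero coordinates `z_i = w_i = 0` is a smooth point. -/
theorem exists_isTangentSpaceAt_of_forall_ne (lam : Fin d → ℂ) (hlam : iotaStar θ lam = β)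
    (b : NStarC θ) (p : levelSet θ α β) (hpb : toY p ∈ residualMuC θ α β lam hlam ⁻¹' {b})
    (hp : ∀ i, ¬ (p.1.1 i = 0 ∧ p.1.2 i = 0)) :
    ∃ W, IsTangentSpaceAt (residualMuC θ α β lam hlam ⁻¹' {b}) p W := by
  let B := Module.finBasis ℝ (LieN θ)
  choose x hx using fun j => Submodule.Quotient.mk_surjective (lieM θ) (B j)
  let D : Fin (Module.finrank ℝ (LieN θ)) → tangentY θ p.1 →ₗ[ℝ] ℂ := fun j =>
    (fderiv ℝ (residualLift lam (x j) (b (B j))) p.1).toLinearMap.comp (tangentY θ p.1).subtype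
  have hD : ∀ j v, D j v = ∑ i, (x j i : ℂ) * prodDiff p.1 v i := fun j v =>
    fderiv_residualLift ..
  refine ⟨_, hpb, Set.univ, isOpen_univ, Set.mem_univ _, Module.finrank ℝ (LieN θ),
    fun j y => residualMuC θ α β lam hlam y (B j) - b (B j), D,
    fun j => isHolomorphicOn_residualMuC_sub lam hlam _ _ _, ?_, fun j => ?_, fun r => ?_, rfl⟩
  · ext y
    simp only [Set.inter_univ, Set.mem_preimage, Set.mem_singleton_iff, Set.mem_ofPred_eq,
      Set.mem_univ, true_and, sub_eq_zero]
    exact ⟨fun h i => by rw [h], fun h => B.ext h⟩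
  · refine ⟨_, _, Set.mem_univ _, ?_, fun v => rfl⟩
    have := isHolomorphicLift_residualLift (α := α) lam hlam (x j) (b (B j))
    rwa [hx] at this
  -- The target values form a functional `b'` on `𝔫`. A vector with `prodDiff` given by `b'` and
  -- `conjDiff = 0` is horizontal because `ι^*` kills `b'`.
  · let b' : NStarC θ := B.constr ℝ r
    obtain ⟨v, hv1, hv2⟩ := exists_conjDiff_prodDiff p.1 0
      (fun i => b' (Submodule.Quotient.mk (Pi.single i 1))) (fun _ _ => rfl)
      (fun i hi => absurd hi (hp i))
    have hv : v ∈ tangentY θ p.1 := by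
      rw [mem_tangentY_iff, hv1, hv2, iotaStar_nStarC]
      exact ⟨map_zero (iotaStarLin θ), rfl⟩
    refine ⟨⟨v, hv⟩, ?_⟩
    funext j
    simp only [hD, hv2]
    rw [← nStarC_mk b', hx]
    exact B.constr_basis ℝ r j

/-- A deformation direction of the real moment map that is `1` at the zero coordinates. -/
theorem exists_direction (hθ : LinearIndependent ℤ θ) (hY : IsSmooth θ α β)
    {p : HSpace d} (hp : p ∈ levelSet θ α β) :
    ∃ u : Fin d → ℝ, (∀ k, ∑ i, u i * (θ k i : ℝ) = 0) ∧
      ∀ i, p.1 i = 0 ∧ p.2 i = 0 → u i = 1 := by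
  classical
  let e : Fin d → ℝ := fun i => if p.1 i = 0 ∧ p.2 i = 0 then 1 else 0
  -- By freeness `ι^* e` can be cancelled by weights that vanish on the zero coordinates, so the
  -- value `1` there survives.
  obtain ⟨c, hc, hc'⟩ := exists_real_weights hθ hY hp fun k => -∑ i, e i * (θ k i : ℝ)
  refine ⟨c + e, fun k => ?_, fun i hi => by simp [hc i hi, e, hi]⟩
  simp only [Pi.add_apply, add_mul, Finset.sum_add_distrib, hc', neg_add_cancel]

theorem continuous_toY : Continuous (toY : levelSet θ α β → Y θ α β) := continuous_quotient_mk'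

/-- Along the direction of `exists_direction` the point stays in the fiber, each zero coordinate
acquires `|z_i|² - |w_i|² = s > 0`, and the other coordinates stay non-zero for small `s`. -/
theorem fiber_subset_closure (hθ : LinearIndependent ℤ θ) (hY : IsSmooth θ α β)
    (lam : Fin d → ℂ) (hlam : iotaStar θ lam = β) (b : NStarC θ) :
    residualMuC θ α β lam hlam ⁻¹' {b} ⊆ closure {y | ∃ p W, toY p = y ∧
      IsTangentSpaceAt (residualMuC θ α β lam hlam ⁻¹' {b}) p W} := by
  intro y hy
  obtain ⟨p, rfl⟩ : ∃ p, toY p = y := Quotient.exists_rep y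
  obtain ⟨u, hu, hu1⟩ := exists_direction hθ hY p.2
  let γ : ℝ → levelSet θ α β := fun s => ⟨momentCurve p.1 u s, momentCurve_mem_levelSet p.2 hu s⟩
  have hγ : Continuous γ := (continuous_momentCurve p.1 u).subtype_mk _
  have hγ0 : γ 0 = p := Subtype.ext (momentCurve_zero _ _)
  have hlim : Tendsto (fun s => toY (γ s)) (𝓝[>] 0) (𝓝 (toY p)) := by
    have := (continuous_toY.comp hγ).tendsto 0
    simp only [Function.comp_apply, hγ0] at this
    exact this.mono_left nhdsWithin_le_nhds
  refine mem_closure_of_tendsto hlim ?_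
  have hne : ∀ᶠ s in 𝓝[>] (0 : ℝ), ∀ i, ¬ ((γ s).1.1 i = 0 ∧ (γ s).1.2 i = 0) := by
    refine eventually_all.2 fun i => ?_
    by_cases hi : p.1.1 i = 0 ∧ p.1.2 i = 0
    · filter_upwards [self_mem_nhdsWithin] with s hs h0
      have := norm_sq_sub_momentCurve p.1 u s i
      change ‖(γ s).1.1 i‖ ^ 2 - ‖(γ s).1.2 i‖ ^ 2 = _ at this
      rw [h0.1, h0.2, hi.1, hi.2, hu1 i hi] at this
      simp only [norm_zero, mul_one] at this
      have hs' : (0 : ℝ) < s := hs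
      linarith
    · have hc : Continuous fun s => ((γ s).1.1 i, (γ s).1.2 i) := by
        have := continuous_subtype_val.comp hγ
        exact ((continuous_apply i).comp (continuous_fst.comp this)).prodMk
          ((continuous_apply i).comp (continuous_snd.comp this))
      have h0 : ((γ 0).1.1 i, (γ 0).1.2 i) ≠ 0 := by
        rw [hγ0]
        intro h
        exact hi ⟨congrArg Prod.fst h, congrArg Prod.snd h⟩
      refine nhdsWithin_le_nhds ?_
      filter_upwards [hc.continuousAt.eventually_ne h0] with s hs h
      exact hs (Prod.ext h.1 h.2)
  filter_upwards [hne] with s hs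
  obtain ⟨W, hW⟩ := exists_isTangentSpaceAt_of_forall_ne lam hlam b (γ s)
    ((mem_fiber_iff lam hlam b _).2
      ((coordProd_momentCurve p.1 u s).trans ((mem_fiber_iff lam hlam b p).1 hy))) hs
  exact ⟨γ s, W, rfl, hW⟩

/-! ### Tangent vectors at smooth points and curves in the fiber -/

theorem exists_open_of_isOpen {U : Set (Y θ α β)} (hU : IsOpen U) :
    ∃ O : Set (HSpace d), IsOpen O ∧ ∀ q : levelSet θ α β, q.1 ∈ O ↔ toY q ∈ U := by
  obtain ⟨O, hO, hOU⟩ := isOpen_induced_iff.1 (hU.preimage continuous_toY)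
  exact ⟨O, hO, fun q => Set.ext_iff.1 hOU q⟩

/-- Velocities of curves in a set `S` at a smooth point are tangent to `S`. -/
theorem mem_of_isTangentSpaceAt_of_curve {S : Set (Y θ α β)} {p : levelSet θ α β}
    {W : Submodule ℝ (tangentY θ p.1)} (hW : IsTangentSpaceAt S p W) {γ : ℝ → HSpace d}
    (hγ0 : γ 0 = p.1) (hmem : ∀ t, γ t ∈ levelSet θ α β) (hS : ∀ t, toY ⟨γ t, hmem t⟩ ∈ S)
    (v : tangentY θ p.1) (hγ : HasDerivWithinAt γ v.1 (Set.Ici 0) 0) : v ∈ W := by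
  obtain ⟨hpS, U, hU, hpU, c, f, D, -, hSU, hD, -, rfl⟩ := hW
  rw [Submodule.mem_iInf]
  intro j
  rw [LinearMap.mem_ker]
  obtain ⟨V, F, hpV, hF, hFD⟩ := hD j
  rw [← hFD v]
  obtain ⟨O, hO, hOU⟩ := exists_open_of_isOpen hU
  have hFdiff : HasFDerivAt F (fderiv ℝ F p.1) (γ 0) := by
    rw [hγ0]
    exact ((hF.smooth.contDiffAt (hF.isOpen.mem_nhds hpV)).differentiableAt
      (by simp)).hasFDerivAt
  have h1 := hFdiff.comp_hasDerivWithinAt (0 : ℝ) hγ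
  have hnear : ∀ᶠ t in 𝓝[Set.Ici 0] (0 : ℝ), γ t ∈ V ∩ O := by
    refine hγ.continuousWithinAt ((hF.isOpen.inter hO).mem_nhds ?_)
    rw [hγ0]
    exact ⟨hpV, (hOU p).2 hpU⟩
  have hzero : ∀ t, γ t ∈ V ∩ O → F (γ t) = 0 := by
    rintro t ⟨htV, htO⟩
    rw [hF.lift ⟨γ t, hmem t⟩ htV]
    have : toY ⟨γ t, hmem t⟩ ∈ S ∩ U := ⟨hS t, (hOU ⟨γ t, hmem t⟩).1 htO⟩
    rw [hSU] at this
    exact this.2 j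
  -- A defining function vanishes along the curve, so its one-sided derivative, also given by the
  -- chain rule, is zero.
  have h2 : HasDerivWithinAt (F ∘ γ) 0 (Set.Ici 0) 0 := by
    refine (hasDerivWithinAt_const (0 : ℝ) (Set.Ici 0) (0 : ℂ)).congr_of_eventuallyEq ?_
      (hzero 0 ?_)
    · filter_upwards [hnear] with t ht using hzero t ht
    · rw [hγ0]
      exact ⟨hpV, (hOU p).2 hpU⟩
  exact UniqueDiffWithinAt.eq_deriv _ (uniqueDiffOn_Ici (0 : ℝ) 0 Set.self_mem_Ici) h1 h2

/-- Tangent spaces of analytic sets at smooth points are complex. -/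
theorem I_smul_mem_of_isTangentSpaceAt {S : Set (Y θ α β)} {p : levelSet θ α β}
    {W : Submodule ℝ (tangentY θ p.1)} (hW : IsTangentSpaceAt S p W) {u v : tangentY θ p.1}
    (hu : u ∈ W) (huv : v.1 = Complex.I • u.1) : v ∈ W := by
  obtain ⟨hpS, U, hU, hpU, c, f, D, -, hSU, hD, -, rfl⟩ := hW
  rw [Submodule.mem_iInf] at *
  intro j
  have hj := hu j
  rw [LinearMap.mem_ker] at *
  obtain ⟨V, F, hpV, hF, hFD⟩ := hD j
  rw [← hFD] at *
  rw [huv, ← I₁_eq_smul, hF.complexLinear p hpV u.1 u.2, hj, mul_zero]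

/-- The hyperkähler moment map of `M` is a submersion along the level set. -/
theorem exists_fderiv_muR_muC_eq (hθ : LinearIndependent ℤ θ) (hY : IsSmooth θ α β)
    (p : levelSet θ α β) (r : Fin m → ℝ) (s : Fin m → ℂ) :
    ∃ v, fderiv ℝ (muR θ) p.1 v = r ∧ fderiv ℝ (muC θ) p.1 v = s := by
  obtain ⟨v, hv⟩ := horizontalEq_surjective hθ hY p.2 (fun k => (r k : ℂ), s)
  have h1 : iotaStar θ (conjDiff p.1 v) = fun k => (r k : ℂ) := congrArg Prod.fst hv
  have h2 : iotaStar θ (prodDiff p.1 v) = s := congrArg Prod.snd hv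
  refine ⟨v, ?_, by rw [fderiv_muC, h2]⟩
  funext k
  rw [fderiv_muR, h1, Complex.ofReal_re]

/-- Every tangent vector at a smooth point is the velocity of a curve in the set. -/
theorem exists_curve_of_isTangentSpaceAt (hθ : LinearIndependent ℤ θ) (hY : IsSmooth θ α β)
    {S : Set (Y θ α β)} {p : levelSet θ α β} {W : Submodule ℝ (tangentY θ p.1)}
    (hW : IsTangentSpaceAt S p W) {v : tangentY θ p.1} (hv : v ∈ W) :
    ∃ γ : ℝ → HSpace d, γ 0 = p.1 ∧ HasDerivAt γ v.1 0 ∧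
      ∀ᶠ t in 𝓝 0, ∃ h : γ t ∈ levelSet θ α β, toY ⟨γ t, h⟩ ∈ S := by
  obtain ⟨hpS, U, hU, hpU, c, f, D, -, hSU, hD, hsurj, rfl⟩ := hW
  choose V F hpV hF hFD using hD
  obtain ⟨O, hO, hOU⟩ := exists_open_of_isOpen hU
  have hFs : ∀ j, HasStrictFDerivAt (F j) (fderiv ℝ (F j) p.1) p.1 := fun j =>
    ((hF j).smooth.contDiffAt ((hF j).isOpen.mem_nhds (hpV j))).hasStrictFDerivAt (by simp)
  have hG := ((contDiff_muR (θ := θ)).contDiffAt.hasStrictFDerivAt (x := p.1) (by simp)).prodMk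
    (((contDiff_muC (θ := θ)).contDiffAt.hasStrictFDerivAt (x := p.1) (by simp)).prodMk
      (hasStrictFDerivAt_pi.2 hFs))
  set G : HSpace d → (Fin m → ℝ) × (Fin m → ℂ) × (Fin c → ℂ) :=
    fun q => (muR θ q, muC θ q, fun j => F j q) with hGdef
  set G' : HSpace d →L[ℝ] (Fin m → ℝ) × (Fin m → ℂ) × (Fin c → ℂ) :=
    (fderiv ℝ (muR θ) p.1).prod ((fderiv ℝ (muC θ) p.1).prod
      (ContinuousLinearMap.pi fun j => fderiv ℝ (F j) p.1)) with hG'def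
  -- A vector `u` realises the moment map components; a horizontal `w`, invisible to them, then
  -- corrects the components of `F`.
  have hrange : G'.range = ⊤ := by
    refine LinearMap.range_eq_top.2 ?_
    rintro ⟨r, s, e⟩
    obtain ⟨u, hu1, hu2⟩ := exists_fderiv_muR_muC_eq hθ hY p r s
    obtain ⟨w, hw⟩ := hsurj fun j => e j - fderiv ℝ (F j) p.1 u
    refine ⟨u + w.1, ?_⟩
    refine Prod.ext ?_ (Prod.ext ?_ ?_)
    · change fderiv ℝ (muR θ) p.1 (u + w.1) = r
      rw [map_add, hu1, w.2.1, add_zero]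
    · change fderiv ℝ (muC θ) p.1 (u + w.1) = s
      rw [map_add, hu2, w.2.2.1, add_zero]
    · funext j
      change fderiv ℝ (F j) p.1 (u + w.1) = e j
      have hwj : D j w = e j - fderiv ℝ (F j) p.1 u := congrFun hw j
      rw [map_add, hFD j w, hwj, add_sub_cancel]
  have hvker : v.1 ∈ G'.ker := by
    rw [Submodule.mem_iInf] at hv
    refine LinearMap.mem_ker.2 (Prod.ext v.2.1 (Prod.ext v.2.2.1 (funext fun j => ?_)))
    change fderiv ℝ (F j) p.1 v.1 = 0
    rw [hFD j v]
    exact LinearMap.mem_ker.1 (hv j)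
  let l : ℝ → G'.ker := fun t => t • ⟨v.1, hvker⟩
  have hl : HasDerivAt l ⟨v.1, hvker⟩ 0 :=
    ((hasDerivAt_id (0 : ℝ)).smul_const (⟨v.1, hvker⟩ : G'.ker)).congr_deriv (one_smul ℝ _)
  have hl0 : l 0 = 0 := zero_smul _ _
  -- The kernel of `G'` parametrises the level set of `G` near `p`, to first order by the identity,
  -- so the line `t • v` becomes a curve of velocity `v`.
  let γ : ℝ → HSpace d := fun t => hG.implicitFunction G G' hrange (G p.1) (l t)
  have hγ0 : γ 0 = p.1 := by
    change hG.implicitFunction G G' hrange (G p.1) (l 0) = p.1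
    rw [hl0, HasStrictFDerivAt.implicitFunction_apply_image]
  have hγ : HasDerivAt γ v.1 0 := by
    have h1 := (hG.to_implicitFunction hrange).hasFDerivAt
    rw [← hl0] at h1
    exact h1.comp_hasDerivAt (0 : ℝ) hl
  refine ⟨γ, hγ0, hγ, ?_⟩
  have hlim : Tendsto (fun t => (G p.1, l t)) (𝓝 0) (𝓝 (G p.1, 0)) := by
    have := hl.continuousAt.tendsto
    rw [hl0] at this
    exact tendsto_const_nhds.prodMk_nhds this
  have hmap := hlim.eventually (hG.map_implicitFunction_eq hrange)
  have hnear : ∀ᶠ t in 𝓝 (0 : ℝ), γ t ∈ O ∩ ⋂ j, V j := by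
    refine hγ.continuousAt ((hO.inter (isOpen_iInter_of_finite fun j =>
      (hF j).isOpen)).mem_nhds ?_)
    rw [hγ0]
    exact ⟨(hOU p).2 hpU, Set.mem_iInter.2 hpV⟩
  filter_upwards [hmap, hnear] with t ht htn
  have ht' : G (γ t) = G p.1 := ht
  have hlev : γ t ∈ levelSet θ α β :=
    ⟨(congrArg Prod.fst ht').trans p.2.1,
      (congrArg (fun x => x.2.1) ht').trans p.2.2⟩
  refine ⟨hlev, ?_⟩
  have hmem : toY ⟨γ t, hlev⟩ ∈ S ∩ U := by
    rw [hSU]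
    refine ⟨(hOU ⟨γ t, hlev⟩).1 htn.1, fun j => ?_⟩
    have hp0 : toY p ∈ S ∩ U := ⟨hpS, hpU⟩
    rw [hSU] at hp0
    have h2 : F j (γ t) = F j p.1 := congrFun (congrArg (fun x => x.2.2) ht') j
    rw [← (hF j).lift ⟨γ t, hlev⟩ (Set.mem_iInter.1 htn.2 j), h2, (hF j).lift p (hpV j)]
    exact hp0.2 j
  exact hmem.1

/-! ### Smooth points of the fibers -/

variable {lam : Fin d → ℂ} {hlam : iotaStar θ lam = β} {b : NStarC θ} {p : levelSet θ α β}
  {W : Submodule ℝ (tangentY θ p.1)}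

/-- Curves through `p` in the level set with constant coordinate products lie in the fiber. -/
theorem toY_mem_fiber_of_coordProd_eq (hp : toY p ∈ residualMuC θ α β lam hlam ⁻¹' {b})
    {q : levelSet θ α β} (h : coordProd q.1 = coordProd p.1) :
    toY q ∈ residualMuC θ α β lam hlam ⁻¹' {b} :=
  (mem_fiber_iff lam hlam b q).2 (h.trans ((mem_fiber_iff lam hlam b p).1 hp))

theorem coordProd_eq_of_mem_fiber (hp : toY p ∈ residualMuC θ α β lam hlam ⁻¹' {b})
    {q : levelSet θ α β} (hq : toY q ∈ residualMuC θ α β lam hlam ⁻¹' {b}) :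
    coordProd q.1 = coordProd p.1 :=
  ((mem_fiber_iff lam hlam b q).1 hq).trans ((mem_fiber_iff lam hlam b p).1 hp).symm

/-- Tangent vectors are velocities of curves in the fiber, along which all products are constant. -/
theorem prodDiff_eq_zero_of_mem (hθ : LinearIndependent ℤ θ) (hY : IsSmooth θ α β)
    (hW : IsTangentSpaceAt (residualMuC θ α β lam hlam ⁻¹' {b}) p W)
    {v : tangentY θ p.1} (hv : v ∈ W) : prodDiff p.1 v.1 = 0 := by
  obtain ⟨γ, hγ0, hγ, hS⟩ := exists_curve_of_isTangentSpaceAt hθ hY hW hv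
  have h1 : HasFDerivAt coordProd (fderiv ℝ coordProd p.1) (γ 0) := by
    rw [hγ0]
    exact (contDiff_coordProd.contDiffAt.differentiableAt (by simp)).hasFDerivAt
  have h2 := h1.comp_hasDerivAt (0 : ℝ) hγ
  rw [fderiv_coordProd] at h2
  refine h2.unique ((hasDerivAt_const (0 : ℝ) (coordProd p.1)).congr_of_eventuallyEq ?_)
  filter_upwards [hS] with t ht
  obtain ⟨h, hS⟩ := ht
  exact coordProd_eq_of_mem_fiber hW.1 hS

/-- Smooth points of the fibers have no zero coordinates `z_i = w_i = 0`. -/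
theorem forall_ne_of_isTangentSpaceAt (hθ : LinearIndependent ℤ θ) (hY : IsSmooth θ α β)
    (hW : IsTangentSpaceAt (residualMuC θ α β lam hlam ⁻¹' {b}) p W) (i : Fin d) :
    ¬ (p.1.1 i = 0 ∧ p.1.2 i = 0) := by
  intro hi
  obtain ⟨u, hu, hu1⟩ := exists_direction hθ hY p.2
  let e : Fin d → ℂ := fun i => if p.1.1 i = 0 ∧ p.1.2 i = 0 then 1 else 0
  have he : ∀ x y : ℂ, ((x • e, y • e) : HSpace d) ∈ tangentY θ p.1 := by
    intro x y
    have hc : conjDiff p.1 (x • e, y • e) = 0 := by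
      funext j
      by_cases hj : p.1.1 j = 0 ∧ p.1.2 j = 0 <;> simp [conjDiff_apply, e, hj]
    have hp : prodDiff p.1 (x • e, y • e) = 0 := by
      funext j
      by_cases hj : p.1.1 j = 0 ∧ p.1.2 j = 0 <;> simp [prodDiff_apply, e, hj]
    rw [mem_tangentY_iff, hc, hp]
    exact ⟨map_zero (iotaStarLin θ), map_zero (iotaStarLin θ)⟩
  have hu' : ∀ k, ∑ i, (-u) i * (θ k i : ℝ) = 0 := fun k => by simp [hu]
  have hpos : (⟨_, he 1 0⟩ : tangentY θ p.1) ∈ W :=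
    mem_of_isTangentSpaceAt_of_curve hW (γ := fun t => momentCurve p.1 u (t ^ 2))
      (by simp [momentCurve_zero]) (fun t => momentCurve_mem_levelSet p.2 hu _)
      (fun t => toY_mem_fiber_of_coordProd_eq hW.1 (coordProd_momentCurve _ _ _)) _
      (by simpa using hasDerivWithinAt_momentCurve_pos p.1 u hu1)
  have hneg : (⟨_, he 0 1⟩ : tangentY θ p.1) ∈ W :=
    mem_of_isTangentSpaceAt_of_curve hW (γ := fun t => momentCurve p.1 (-u) (t ^ 2))
      (by simp [momentCurve_zero]) (fun t => momentCurve_mem_levelSet p.2 hu' _)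
      (fun t => toY_mem_fiber_of_coordProd_eq hW.1 (coordProd_momentCurve _ _ _)) _
      (by simpa using hasDerivWithinAt_momentCurve_neg p.1 (-u) (fun j hj => by simp [hu1 j hj]))
  -- Both branch velocities lie in the linear space `W`, so their sum does too. A curve with that
  -- velocity has `z_i` and `w_i` non-zero for small `t ≠ 0`, although the fiber forces `z_i w_i =
  -- 0`.
  obtain ⟨γ, hγ0, hγ, hS⟩ := exists_curve_of_isTangentSpaceAt hθ hY hW (W.add_mem hpos hneg)
  have h1 : HasDerivAt (fun t => (γ t).1 i) 1 0 := by
    have := hasDerivAt_pi.1 hγ.fst i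
    simpa [e, hi] using this
  have h2 : HasDerivAt (fun t => (γ t).2 i) 1 0 := by
    have := hasDerivAt_pi.1 hγ.snd i
    simpa [e, hi] using this
  have h3 := h1.eventually_ne (c := 0) one_ne_zero
  have h4 := h2.eventually_ne (c := 0) one_ne_zero
  obtain ⟨t, ht1, ht2, h, hS⟩ := (h3.and (h4.and (nhdsWithin_le_nhds hS))).exists
  have h5 := congrFun (coordProd_eq_of_mem_fiber hW.1 hS) i
  simp only [coordProd, hi.1, zero_mul] at h5
  exact (mul_ne_zero ht1 ht2) h5

/-! ### Torus directions -/

theorem torusAct_mem_levelSet (ζ : Fin d → Circle) {p : HSpace d} (hp : p ∈ levelSet θ α β) :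
    torusAct ζ p ∈ levelSet θ α β ∧ coordProd (torusAct ζ p) = coordProd p := by
  have h : coordProd (torusAct ζ p) = coordProd p := by
    funext i
    have hne : (ζ i : ℂ) ≠ 0 := Circle.coe_ne_zero _
    simp only [coordProd, torusAct, Circle.coe_inv]
    field_simp
  refine ⟨⟨?_, ?_⟩, h⟩
  · rw [← hp.1]
    funext k
    simp only [muR, torusAct, norm_mul, Circle.norm_coe, mul_one]
  · rw [muC_eq_iotaStar_coordProd, h]
    exact hp.2

theorem hasDerivAt_torusAct (ξ : Fin d → ℝ) (p : HSpace d) :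
    HasDerivAt (fun t : ℝ => torusAct (fun i => Circle.exp (t * ξ i)) p) (infinitesimal ξ p) 0 := by
  have h : ∀ x : ℝ, HasDerivAt (fun t : ℝ => ((Circle.exp (t * x) : Circle) : ℂ))
      (Complex.I * x) 0 := by
    intro x
    have h1 : HasDerivAt (fun t : ℝ => ((t * x : ℝ) : ℂ) * Complex.I) (Complex.I * x) 0 := by
      have := (((hasDerivAt_id (0 : ℝ)).mul_const x).ofReal_comp).mul_const Complex.I
      simpa [mul_comm] using this
    simpa [Circle.coe_exp] using h1.cexp
  refine HasDerivAt.prodMk (hasDerivAt_pi.2 fun i => ?_) (hasDerivAt_pi.2 fun i => ?_)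
  · exact ((h (ξ i)).const_mul (p.1 i)).congr_deriv (by ring)
  · have := (h (-ξ i)).const_mul (p.2 i)
    simp only [mul_neg, Circle.exp_neg] at this
    exact this.congr_deriv (by push_cast; ring)

theorem conjDiff_infinitesimal (ξ : Fin d → ℝ) (p : HSpace d) (i : Fin d) :
    conjDiff p (infinitesimal ξ p) i =
      Complex.I * ξ i * (p.1 i * star (p.1 i) + p.2 i * star (p.2 i)) := by
  simp only [conjDiff_apply, infinitesimal]
  ring

theorem prodDiff_infinitesimal (ξ : Fin d → ℝ) (p : HSpace d) :
    prodDiff p (infinitesimal ξ p) = 0 := by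
  funext i
  simp only [prodDiff_apply, infinitesimal, Pi.zero_apply]
  ring

theorem eq_zero_of_conjDiff_prodDiff {p : HSpace d} (hp : ∀ i, ¬ (p.1 i = 0 ∧ p.2 i = 0))
    {v : HSpace d} (h1 : conjDiff p v = 0) (h2 : prodDiff p v = 0) : v = 0 := by
  have h1' := fun i => congrFun h1 i
  have h2' := fun i => congrFun h2 i
  simp only [conjDiff_apply, prodDiff_apply, Pi.zero_apply] at h1' h2'
  ext i
  · refine (mul_eq_zero.1 ?_).resolve_left (norm_sq_add_norm_sq_ne_zero (hp i))
    linear_combination (p.1 i) * h1' i + star (p.2 i) * h2' i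
  · refine (mul_eq_zero.1 ?_).resolve_left (norm_sq_add_norm_sq_ne_zero (hp i))
    linear_combination star (p.1 i) * h2' i - (p.2 i) * h1' i

/-- The rotation speed that gives `conjDiff` the prescribed imaginary part. -/
theorem exists_infinitesimal {p : HSpace d} (hp : ∀ i, ¬ (p.1 i = 0 ∧ p.2 i = 0))
    (r : Fin d → ℝ) : ∃ ξ, ∀ i, conjDiff p (infinitesimal ξ p) i = Complex.I * r i := by
  refine ⟨fun i => r i / (Complex.normSq (p.1 i) + Complex.normSq (p.2 i)), fun i => ?_⟩
  have h := norm_sq_add_norm_sq_ne_zero (hp i)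
  have h' : p.1 i * star (p.1 i) + p.2 i * star (p.2 i) =
      (Complex.normSq (p.1 i) : ℂ) + Complex.normSq (p.2 i) := by
    simp [Complex.mul_conj]
  rw [conjDiff_infinitesimal, h']
  rw [h'] at h
  push_cast
  rw [mul_assoc, div_mul_cancel₀ _ h]

/-- All of `T^d`, and not only `M`, preserves the level set and the products, so its orbits are
curves in the fiber. -/
theorem infinitesimal_mem (hW : IsTangentSpaceAt (residualMuC θ α β lam hlam ⁻¹' {b}) p W)
    {ξ : Fin d → ℝ} (hξ : infinitesimal ξ p.1 ∈ tangentY θ p.1) :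
    (⟨_, hξ⟩ : tangentY θ p.1) ∈ W :=
  mem_of_isTangentSpaceAt_of_curve hW
    (γ := fun t => torusAct (fun i => Circle.exp (t * ξ i)) p.1)
    (by ext i <;> simp [torusAct]) (fun t => (torusAct_mem_levelSet _ p.2).1)
    (fun t => toY_mem_fiber_of_coordProd_eq hW.1 (torusAct_mem_levelSet _ p.2).2) _
    (hasDerivAt_torusAct ξ p.1).hasDerivWithinAt

/-- The tangent space of a fiber at a smooth point is the kernel of the differential of the
residual moment map. -/
theorem mem_iff_prodDiff_eq_zero (hθ : LinearIndependent ℤ θ) (hY : IsSmooth θ α β)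
    (hW : IsTangentSpaceAt (residualMuC θ α β lam hlam ⁻¹' {b}) p W) (v : tangentY θ p.1) :
    v ∈ W ↔ prodDiff p.1 v.1 = 0 := by
  refine ⟨fun hv => prodDiff_eq_zero_of_mem hθ hY hW hv, fun hv => ?_⟩
  have hp := forall_ne_of_isTangentSpaceAt hθ hY hW
  have hcv := ((mem_tangentY_iff p.1 v.1).1 v.2).1
  -- Torus directions have purely imaginary `conjDiff`. Thus `ξ` matches the imaginary part for `v`,
  -- and `I • infinitesimal η` the real part, the sign absorbing `I² = -1`. Both are horizontal
  -- because `ι^*` has real coefficients.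
  obtain ⟨ξ, hξ⟩ := exists_infinitesimal hp fun i => (conjDiff p.1 v.1 i).im
  obtain ⟨η, hη⟩ := exists_infinitesimal hp fun i => -(conjDiff p.1 v.1 i).re
  have hξt : infinitesimal ξ p.1 ∈ tangentY θ p.1 := by
    rw [mem_tangentY_iff, prodDiff_infinitesimal]
    refine ⟨?_, map_zero (iotaStarLin θ)⟩
    funext k
    have := congrArg (fun x => Complex.im (x k)) hcv
    apply Complex.ext <;> simp [iotaStar, hξ] at this ⊢
    exact this
  have hηt : infinitesimal η p.1 ∈ tangentY θ p.1 := by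
    rw [mem_tangentY_iff, prodDiff_infinitesimal]
    refine ⟨?_, map_zero (iotaStarLin θ)⟩
    funext k
    have := congrArg (fun x => Complex.re (x k)) hcv
    apply Complex.ext <;> simp [iotaStar, hη] at this ⊢
    exact this
  have hηt' : Complex.I • infinitesimal η p.1 ∈ tangentY θ p.1 := by
    rw [mem_tangentY_iff, map_smul, map_smul, ← iotaStarLin_apply, ← iotaStarLin_apply, map_smul,
      map_smul]
    rw [mem_tangentY_iff] at hηt
    simp [hηt]
  have hv' : v = ⟨_, hξt⟩ + ⟨_, hηt'⟩ := by
    apply Subtype.ext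
    rw [← sub_eq_zero]
    refine eq_zero_of_conjDiff_prodDiff hp ?_ ?_
    · funext i
      simp only [Submodule.coe_add, map_sub, map_add, map_smul, Pi.sub_apply, Pi.add_apply,
        Pi.smul_apply, hξ, hη, smul_eq_mul, Pi.zero_apply]
      apply Complex.ext <;> simp
    · simp only [Submodule.coe_add, map_sub, map_add, map_smul, hv, prodDiff_infinitesimal,
        smul_zero, add_zero, sub_zero]
  rw [hv']
  exact W.add_mem (infinitesimal_mem hW hξt)
    (I_smul_mem_of_isTangentSpaceAt hW (infinitesimal_mem hW hηt) rfl)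

/-! ### Lagrangian fibers -/

theorem omegaC_eq (u v : HSpace d) :
    omegaC u v = Complex.I * ∑ i, (u.1 i * v.2 i - u.2 i * v.1 i) := by
  simp only [omegaC, ω₂, ω₃, metric, I₃, I₁, I₂]
  apply Complex.ext
  · simp [Finset.sum_add_distrib, Finset.sum_neg_distrib, Finset.sum_sub_distrib]
    ring
  · simp [Finset.sum_add_distrib, Finset.sum_neg_distrib, Finset.sum_sub_distrib]
    ring

/-- In each coordinate the kernel of `(w_i, z_i) ≠ 0` is a complex line in `ℂ²`, and `dz_i ∧ dw_i`
vanishes on a line. -/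
theorem omegaC_eq_zero_of_prodDiff {p u v : HSpace d} (hp : ∀ i, ¬ (p.1 i = 0 ∧ p.2 i = 0))
    (hu : prodDiff p u = 0) (hv : prodDiff p v = 0) : omegaC u v = 0 := by
  rw [omegaC_eq, Finset.sum_eq_zero, mul_zero]
  intro i _
  have h1 := congrFun hu i
  have h2 := congrFun hv i
  simp only [prodDiff_apply, Pi.zero_apply] at h1 h2
  refine (mul_eq_zero.1 ?_).resolve_left (norm_sq_add_norm_sq_ne_zero (hp i))
  linear_combination (star (p.2 i) * v.2 i - star (p.1 i) * v.1 i) * h1 +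
    (star (p.1 i) * u.1 i - star (p.2 i) * u.2 i) * h2

/-- The equations of the horizontal vectors tangent to the fibers of the residual moment map. -/
def fiberEq (θ : Fin m → Fin d → ℤ) (p : HSpace d) :
    HSpace d →ₗ[ℂ] (Fin m → ℂ) × (Fin d → ℂ) :=
  ((iotaStarLin θ).comp (conjDiff p)).prod (prodDiff p)

theorem fiberEq_surjective (hθ : LinearIndependent ℤ θ) (hY : IsSmooth θ α β) {p : HSpace d}
    (hpl : p ∈ levelSet θ α β) (hp : ∀ i, ¬ (p.1 i = 0 ∧ p.2 i = 0)) :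
    Function.Surjective (fiberEq θ p) := by
  rintro ⟨r, e⟩
  obtain ⟨c, hc, rfl⟩ := exists_complex_weights hθ hY hpl r
  obtain ⟨v, rfl, rfl⟩ := exists_conjDiff_prodDiff p c e hc fun i hi => absurd hi (hp i)
  exact ⟨v, rfl⟩

/-- `W` is the kernel of `m + d` independent complex equations on `ℂ^{2d}`, hence of complex
dimension `n`, half of `2n`. -/
theorem isLagrangian_of_isTangentSpaceAt {n : ℕ} (hd : m + n = d) (hθ : LinearIndependent ℤ θ)
    (hY : IsSmooth θ α β) (hW : IsTangentSpaceAt (residualMuC θ α β lam hlam ⁻¹' {b}) p W) :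
    IsLagrangian W := by
  have hp := forall_ne_of_isTangentSpaceAt hθ hY hW
  have hmem := mem_iff_prodDiff_eq_zero hθ hY hW
  refine ⟨fun u hu v hv =>
    omegaC_eq_zero_of_prodDiff hp ((hmem u).1 hu) ((hmem v).1 hv), ?_⟩
  have h1 := (fiberEq θ p.1).finrank_range_add_finrank_ker
  rw [LinearMap.range_eq_top.2 (fiberEq_surjective hθ hY p.2 hp), finrank_top] at h1
  simp only [Module.finrank_prod, Module.finrank_fin_fun] at h1
  have hmap : W.map (tangentY θ p.1).subtype =
      (LinearMap.ker (fiberEq θ p.1)).restrictScalars ℝ := by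
    ext v
    rw [Submodule.mem_map, Submodule.restrictScalars_mem, LinearMap.mem_ker]
    change _ ↔ (iotaStar θ (conjDiff p.1 v), prodDiff p.1 v) = 0
    rw [Prod.mk_eq_zero]
    constructor
    · rintro ⟨w, hw, rfl⟩
      exact ⟨((mem_tangentY_iff _ _).1 w.2).1, (hmem w).1 hw⟩
    · rintro ⟨h2, h3⟩
      have hv : v ∈ tangentY θ p.1 :=
        (mem_tangentY_iff _ _).2 ⟨h2, by rw [h3]; exact map_zero (iotaStarLin θ)⟩
      exact ⟨⟨v, hv⟩, (hmem _).2 h3, rfl⟩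
  have h2 : Module.finrank ℝ W = 2 * Module.finrank ℂ (LinearMap.ker (fiberEq θ p.1)) := by
    rw [← Submodule.finrank_map_subtype_eq, hmap]
    exact finrank_real_of_complex (LinearMap.ker (fiberEq θ p.1))
  rw [h2, finrank_tangentY hd hθ hY p.2]
  omega

end ToricHyperkahler
end

theorem theorem4p1 {d m n : ℕ} (hd : m + n = d)
    (θ : Fin m → Fin d → ℤ) (hθ : LinearIndependent ℤ θ)
    (α : Fin m → ℝ) (β : Fin m → ℂ) (hY : ToricHyperkahler.IsSmooth θ α β)
    (lam : Fin d → ℂ) (hlam : ToricHyperkahler.iotaStar θ lam = β) :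
    Module.finrank ℂ (ToricHyperkahler.NStarC θ) = n ∧
    (∀ p ∈ ToricHyperkahler.levelSet θ α β,
      Module.finrank ℝ (ToricHyperkahler.tangentY θ p) = 4 * n) ∧
    ToricHyperkahler.IsHolomorphicMap (ToricHyperkahler.residualMuC θ α β lam hlam) ∧
    Function.Surjective (ToricHyperkahler.residualMuC θ α β lam hlam) ∧
    ∀ b : ToricHyperkahler.NStarC θ,
      ToricHyperkahler.IsComplexLagrangianSubvariety
        (ToricHyperkahler.residualMuC θ α β lam hlam ⁻¹' {b}) :=
  ⟨ToricHyperkahler.finrank_nStarC hd hθ,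
    fun _ hp => ToricHyperkahler.finrank_tangentY hd hθ hY hp,
    ToricHyperkahler.isHolomorphicMap_residualMuC lam hlam,
    ToricHyperkahler.residualMuC_surjective hθ lam hlam,
    fun b =>
      { analytic := ToricHyperkahler.isAnalyticSubvariety_fiber lam hlam b
        smooth_dense := ToricHyperkahler.fiber_subset_closure hθ hY lam hlam b
        lagrangian := fun _ _ hW =>
          ToricHyperkahler.isLagrangian_of_isTangentSpaceAt hd hθ hY hW }⟩
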